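/- Let $f:\mathbb R^d\to\mathbb R$ be convex and let $0<\beta_1<\sqrt{\beta_2}$, $\beta_2<1$, $0<\lambda<1$, $\eta_0>0$, $\epsilon\ge 0$, $x_0\in\mathbb R^d$. Adam++ is the following algorithm. With $m_{-1}=v_{-1}=0$ and all vector operations entrywise, for $t=0,1,2,\dots$: set $\eta_t=\max(\eta_{t-1},\|x_t-x_0\|_2/\sqrt d)$ for $t\ge1$; receive a stochastic gradient $g_t$ at $x_t$; set $\beta_{1t}=\beta_1\lambda^t$ and $m_t=\beta_{1t}m_{t-1}+(1-\beta_{1t})g_t$; set either (Case 1) $s_t=(\sum_{k=0}^t g_k^2)^{1/2}$, or (Case 2) $v_t=\beta_2v_{t-1}+(1-\beta_2)g_t^2$ and $s_t=\sqrt{(t+1)\max_{t'\le t}v_{t'}}$; set $h_t=\epsilon+s_t$ and $x_{t+1}=x_t-\eta_t\, m_t/h_t$ (a coordinate in which $h_t$ vanishes is not moved). Assume that, given the history before step $t$, the conditional mean of $g_t$ belongs to the subdifferential $\partial f(x_t)$, and that there is a continuous $l:\mathbb R^d\to\mathbb R$ with $\|g_t\|_2\le l(x_t)$ almost surely for all $t$.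 Then there is a constant $C$, depending only on $\beta_1,\beta_2,\lambda$, such that for all $T\ge1$, $\delta\in(0,1)$, $L>0$ and $x^*\in\mathbb R^d$, with probability at least $1-\delta-\mathbb P(\max_{t\le T}l(x_t)>L)$ the following holds for every $\tau\in\arg\max_{t\le T}\sum_{i=0}^{t-1}\eta_i/\eta_t$ with $\eta_0\le D_\tau$ (and in Case 1 with $\epsilon=0$ for every such maximizer $\tau$, without the restriction $\eta_0\le D_\tau$): $$f(\overline x_\tau)\le f(x^*)+C\left(\frac{D_\tau^2\sqrt d\,\|h_\tau\|_2}{\eta_0T}+\frac{\overline D_\tau\sqrt{\theta_{\tau,\delta}\|s_\tau\|_2^2+L^2\theta_{\tau,\delta}^2}}{T}\right)\left(1+\log\frac{\eta_T}{\eta_0}\right),$$ where $\overline x_\tau=\sum_{t=0}^{\tau-1}\eta_tx_t\big/\sum_{t=0}^{\tau-1}\eta_t$, $D_\tau=\max_{t\le\tau}\|x_t-x^*\|_\infty$, $\overline D_\tau=\max_{t\le\tau}\|x_t-x^*\|_2$ and $\theta_{t,\delta}=\log\bigl(60\log(6t)/\delta\bigr)$. -/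

import Mathlib

open MeasureTheory ProbabilityTheory
open scoped RealInnerProductSpace

noncomputable section

namespace AdamPP

/-- `ℝ^d` with the Euclidean norm. -/
abbrev Vec (d : ℕ) := EuclideanSpace ℝ (Fin d)

/-- `max_{k ≤ t} a k`. -/
def runMax (a : ℕ → ℝ) (t : ℕ) : ℝ :=
  (Finset.range (t + 1)).sup' Finset.nonempty_range_add_one a

/-- `θ_{t,δ} = log (60 log (6 t) / δ)`. -/
def theta (t : ℕ) (δ : ℝ) : ℝ := Real.log (60 * Real.log (6 * t) / δ)

/-- `log₊ z = 1 + log z`, for `z ≥ 1`. -/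
def logPlus (z : ℝ) : ℝ := 1 + Real.log z

/-- The sequence of stochastic gradients on the sample point `ω`. -/
def path {d : ℕ} {Ω : Type*} (g : ℕ → Ω → Vec d) (ω : Ω) : ℕ → Vec d := fun k => g k ω

/-- The two choices of the second-moment quantity `s_t`. -/
inductive Variant
  /-- Case 1: cumulative sum of squares. -/
  | case1
  /-- Case 2: scaled running maximum of an exponential moving average. -/
  | case2

/-- The inputs of the algorithm: the initial point `x₀`, the initial distance `η₀`, the
stabilizer added to the diagonal of `H_t`, the moment parameters, and the choice of `s_t`. -/
structure Input (d : ℕ) where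
  x₀ : Vec d
  η₀ : ℝ
  stab : ℝ
  β₁ : ℝ
  β₂ : ℝ
  lam : ℝ
  variant : Variant

namespace Input

variable {d : ℕ} (A : Input d)

/-- `β_{1t} = β₁ λ^t`. -/
def beta1 (t : ℕ) : ℝ := A.β₁ * A.lam ^ t

/-- `m_t = β_{1t} m_{t-1} + (1 - β_{1t}) g_t`, with `m_{-1} = 0`. -/
def m (g : ℕ → Vec d) : ℕ → Vec d
  | 0 => (1 - A.beta1 0) • g 0
  | t + 1 => A.beta1 (t + 1) • m g t + (1 - A.beta1 (t + 1)) • g (t + 1)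

/-- `v_t = β₂ v_{t-1} + (1 - β₂) g_t²` (entrywise), with `v_{-1} = 0`. -/
def v (g : ℕ → Vec d) : ℕ → Fin d → ℝ
  | 0 => fun i => (1 - A.β₂) * g 0 i ^ 2
  | t + 1 => fun i => A.β₂ * v g t i + (1 - A.β₂) * g (t + 1) i ^ 2

/-- `s_t`, entrywise: `(∑_{k ≤ t} g_k²)^{1/2}` in Case 1 and
`((t + 1) max_{k ≤ t} v_k)^{1/2}` in Case 2. -/
def s (g : ℕ → Vec d) (t : ℕ) : Vec d :=
  match A.variant with
  | .case1 => WithLp.toLp 2 fun i => √(∑ k ∈ Finset.range (t + 1), g k i ^ 2)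
  | .case2 => WithLp.toLp 2 fun i => √(((t : ℝ) + 1) * runMax (fun k => A.v g k i) t)

/-- The diagonal of `H_t = stab + diag(s_t)`. -/
def h (g : ℕ → Vec d) (t : ℕ) : Vec d :=
  WithLp.toLp 2 fun i => A.stab + A.s g t i

/-- The pair `(x_t, η_t)` when the stochastic gradients received are `g 0, g 1, …`:
`η_t = max (η_{t-1}) (‖x_t - x₀‖₂ / √d)` and `x_{t+1} = x_t - η_t H_t⁻¹ m_t`.
A coordinate whose diagonal entry of `H_t` is `0` (possible only if `stab = 0` and all its
gradient entries so far vanish) is not moved, since division by `0` gives `0`. -/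
def traj (g : ℕ → Vec d) : ℕ → Vec d × ℝ
  | 0 => (A.x₀, A.η₀)
  | t + 1 =>
    let x := (traj g t).1
    let η := (traj g t).2
    let x' := x - η • WithLp.toLp 2 fun i => A.m g t i / A.h g t i
    (x', max η (‖x' - A.x₀‖ / √d))

/-- The iterate `x_t`. It depends only on `g 0, …, g (t - 1)`. -/
def x (g : ℕ → Vec d) (t : ℕ) : Vec d := (A.traj g t).1

/-- The normalized distance `η_t`. It depends only on `g 0, …, g (t - 1)`. -/
def η (g : ℕ → Vec d) (t : ℕ) : ℝ := (A.traj g t).2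

/-- `τ ∈ argmax_{t ≤ T} ∑_{i < t} η_i / η_t`. -/
def IsStopIndex (g : ℕ → Vec d) (T τ : ℕ) : Prop :=
  τ ≤ T ∧ ∀ t ≤ T, ∑ i ∈ Finset.range t, A.η g i / A.η g t ≤
    ∑ i ∈ Finset.range τ, A.η g i / A.η g τ

/-- `x̄_t = (∑_{k < t} η_k x_k) / (∑_{k < t} η_k)`. -/
def xbar (g : ℕ → Vec d) (t : ℕ) : Vec d :=
  (∑ k ∈ Finset.range t, A.η g k)⁻¹ • ∑ k ∈ Finset.range t, A.η g k • A.x g k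

/-- `D_t = max_{k ≤ t} ‖x_k - x*‖_∞`. -/
def D (g : ℕ → Vec d) (xs : Vec d) (t : ℕ) : ℝ :=
  runMax (fun k => ‖WithLp.ofLp (A.x g k - xs)‖) t

/-- `D̄_t = max_{k ≤ t} ‖x_k - x*‖₂`. -/
def Dbar (g : ℕ → Vec d) (xs : Vec d) (t : ℕ) : ℝ :=
  runMax (fun k => ‖A.x g k - xs‖) t

/-- The rate
`(D_τ² √d ‖h_τ‖₂ / (η₀ T) + D̄_τ √(θ_{τ,δ} ‖s_τ‖₂² + L² θ_{τ,δ}²) / T) log₊ (η_T / η₀)`,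
where `h_τ = stab + s_τ` is the diagonal of `H_τ`. -/
def rate (g : ℕ → Vec d) (xs : Vec d) (T τ : ℕ) (L δ : ℝ) : ℝ :=
  (A.D g xs τ ^ 2 * √d * ‖A.h g τ‖ / (A.η₀ * T) +
    A.Dbar g xs τ * √(theta τ δ * ‖A.s g τ‖ ^ 2 + L ^ 2 * theta τ δ ^ 2) / T) *
  logPlus (A.η g T / A.η₀)

end Input

/-- The subdifferential `∂f(x)` of a convex function. -/
def subdiff {d : ℕ} (f : Vec d → ℝ) (x : Vec d) : Set (Vec d) :=
  {u | ∀ y, f x + ⟪u, y - x⟫ ≤ f y}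

/-- `g 0, g 1, …` are the answers of a stochastic (sub)gradient oracle for `f`, queried at the
points that the algorithm produces from them. `ℱ t` is the history before query `t`: the answer
`g t` belongs to `ℱ (t + 1)`, and given `ℱ t` its mean is a subgradient of `f` at `x_t`.
This includes answers `G(x_t, ξ_t)` with independent `ξ_t` and `𝔼 G(x, ξ_t) ∈ ∂f(x)`. -/
structure IsOracleRun {d : ℕ} {Ω : Type*} {mΩ : MeasurableSpace Ω} (A : Input d)
    (μ : Measure Ω) (ℱ : Filtration ℕ mΩ) (f : Vec d → ℝ) (g : ℕ → Ω → Vec d) : Prop where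
  measurable : ∀ t, Measurable[ℱ (t + 1)] (g t)
  integrable : ∀ t, Integrable (g t) μ
  mean_mem : ∀ t, ∀ᵐ ω ∂μ, (μ[g t | ℱ t]) ω ∈ subdiff f (A.x (path g ω) t)

end AdamPP

end

/-! Fix a path, let `p_k` be the conditional mean of `g_k` and write `τ = n + 1`. The subgradient
inequality and Jensen bound `(∑_{k<τ} η_k) (f(x̄_τ) - f(x*))` by `∑ η_k ⟪p_k, x_k - x*⟫`. This
splits into the regret `∑ η_k ⟪g_k, x_k - x*⟫` and the noise `∑ η_k ⟪p_k - g_k, x_k - x*⟫`.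

Regret (`IsGradScale.regret_le`): the coordinates decouple and the AdaGrad argument applies to each.
Expanding the square of a step gives differences of squares, which sum to at most `h_n D²` because
`h` is monotone, plus `η_n² ∑ m_t² / h_t`, where the sum is of order `s_n`. Replacing `m_t` by `g_t`
costs a convergent series, since `β_{1t}` decays geometrically. The remaining factors `η_n` are
absorbed in `D`: `η_n ≤ max η₀ (2 D)`, and `η₀` is at most a multiple of `D` by hypothesis or, in
Case 1 without stabilizer, because the first nonzero gradient moves a coordinate by at least `(1 -
β₁) η₀`.

Noise: the weights `η_k D̄_k` are random and have no a priori bound, but they are nondecreasing.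
Summation by parts therefore reduces the noise to the partial sums of `⟪g_k - p_k, u_k⟫`, where `u_k
= (x_k - x*) / D̄_k` has norm at most 1 and is known before `g_k`. A time-uniform empirical
Bernstein inequality controls all these partial sums at once
(`measureReal_exists_sqrt_lt_abs_sum_le`). Setting `u_k` to zero where `l(x_k) > L` makes the
increments bounded, and changes nothing up to time `T` when `max l(x_t) ≤ L`.

Weight: the choice of `τ` gives `∑_{k<τ} η_k ≥ η_n T / (2 log₊(η_T/η₀))` (`IsStopIndex.mul_le_sum`).
Dividing by this cancels the factor `η_n` of the noise and leaves `1/η_n ≤ 1/η₀` in the regret term.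
-/

/-! ### Growth of the weights and summation by parts -/

open Finset in
-- The hypothesis says that each new term is at least `1/R` of the sum before it, so the partial
-- sums grow by the factor `1 + 1/R`. They start from at least `R η₀` after `⌈R⌉` terms and end
-- below `R η_T`, and `log (1 + 1/R) ≥ 1/(2R)`.
theorem le_two_mul_mul_one_add_log {η : ℕ → ℝ} (hη : Monotone η) (h0 : 0 < η 0) {T : ℕ} {R : ℝ}
    (hR : 1 ≤ R) (hsum : ∀ t ≤ T, ∑ i ∈ range t, η i ≤ R * η t) :
    (T : ℝ) ≤ 2 * R * (1 + Real.log (η T / η 0)) := by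
  have hR0 : 0 < R := by linarith
  have hpos : ∀ t, 0 < η t := fun t => h0.trans_le (hη (Nat.zero_le t))
  have hlog : 0 ≤ Real.log (η T / η 0) :=
    Real.log_nonneg ((one_le_div h0).2 (hη (Nat.zero_le T)))
  have hceil : (⌈R⌉₊ : ℝ) < R + 1 := Nat.ceil_lt_add_one hR0.le
  have hmul := mul_nonneg hR0.le hlog
  rcases le_total T ⌈R⌉₊ with hT | hT
  · have : (T : ℝ) ≤ ⌈R⌉₊ := by exact_mod_cast hT
    nlinarith
  · have key : ∀ n, ⌈R⌉₊ + n ≤ T →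
        R * η 0 * (1 + 1 / R) ^ n ≤ ∑ i ∈ range (⌈R⌉₊ + n), η i := by
      intro n
      induction n with
      | zero =>
        intro _
        have h1 : ∑ i ∈ range ⌈R⌉₊, η 0 ≤ ∑ i ∈ range ⌈R⌉₊, η i :=
          sum_le_sum fun i _ => hη (Nat.zero_le i)
        simp only [sum_const, card_range, nsmul_eq_mul] at h1
        have h2 := mul_le_mul_of_nonneg_right (Nat.le_ceil R) h0.le
        simpa using h2.trans h1
      | succ n ih =>
        intro hn
        have h1 := ih (by omega)
        have h2 := hsum (⌈R⌉₊ + n) (by omega)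
        rw [← add_assoc, sum_range_succ, pow_succ, ← mul_assoc]
        have h3 : (∑ i ∈ range (⌈R⌉₊ + n), η i) * (1 / R) ≤ η (⌈R⌉₊ + n) := by
          rw [mul_one_div, div_le_iff₀ hR0]; linarith
        calc R * η 0 * (1 + 1 / R) ^ n * (1 + 1 / R)
            ≤ (∑ i ∈ range (⌈R⌉₊ + n), η i) * (1 + 1 / R) :=
              mul_le_mul_of_nonneg_right h1 (by positivity)
          _ ≤ _ := by linarith
    have h1 := key (T - ⌈R⌉₊) (by omega)
    rw [Nat.add_sub_cancel' hT] at h1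
    have h2 : (1 + 1 / R) ^ (T - ⌈R⌉₊) ≤ η T / η 0 := by
      rw [le_div_iff₀ h0]
      have := h1.trans (hsum T le_rfl)
      rw [mul_assoc] at this
      linarith [le_of_mul_le_mul_left this hR0]
    have h3 := Real.log_le_log (by positivity) h2
    rw [Real.log_pow, Nat.cast_sub hT] at h3
    have h4 : 1 / (2 * R) ≤ Real.log (1 + 1 / R) := by
      have := Real.one_sub_inv_le_log_of_pos (show 0 < 1 + 1 / R by positivity)
      refine le_trans ?_ this
      rw [show 1 - (1 + 1 / R)⁻¹ = 1 / (R + 1) by field_simp; ring]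
      exact one_div_le_one_div_of_le (by linarith) (by linarith)
    have h5 : (0 : ℝ) ≤ T - ⌈R⌉₊ := sub_nonneg.2 (by exact_mod_cast hT)
    have h6 := (mul_le_mul_of_nonneg_left h4 h5).trans h3
    rw [mul_one_div, div_le_iff₀ (by positivity)] at h6
    nlinarith

open Finset in
-- Abel summation: the deviation of the weighted sum from `a j` times the partial sum grows by at
-- most `(a (j+1) - a j) B` per step, and these increments telescope.
theorem abs_sum_mul_le_of_monotone {a X : ℕ → ℝ} (ha : Monotone a) (ha0 : 0 ≤ a 0) {B : ℝ} {n : ℕ}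
    (hB : ∀ t ≤ n + 1, |∑ k ∈ range t, X k| ≤ B) :
    |∑ k ∈ range (n + 1), a k * X k| ≤ 2 * a n * B := by
  have key : ∀ j ≤ n, |∑ k ∈ range (j + 1), a k * X k - a j * ∑ k ∈ range (j + 1), X k| ≤
      (a j - a 0) * B := by
    intro j
    induction j with
    | zero => simp
    | succ j ih =>
      intro hj
      have h1 := ih (by omega)
      have h2 : |(a j - a (j + 1)) * ∑ k ∈ range (j + 1), X k| ≤ (a (j + 1) - a j) * B := by
        rw [abs_mul, abs_sub_comm, abs_of_nonneg (sub_nonneg.2 (ha j.le_succ))]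
        exact mul_le_mul_of_nonneg_left (hB _ (by omega)) (sub_nonneg.2 (ha j.le_succ))
      rw [sum_range_succ _ (j + 1), sum_range_succ X (j + 1)]
      calc _ = |(∑ k ∈ range (j + 1), a k * X k - a j * ∑ k ∈ range (j + 1), X k) +
            (a j - a (j + 1)) * ∑ k ∈ range (j + 1), X k| := by congr 1; ring
        _ ≤ _ := abs_add_le _ _
        _ ≤ _ := by linarith
  have h1 := key n le_rfl
  have hB0 : 0 ≤ B := (abs_nonneg _).trans (hB 0 (by omega))
  have han : 0 ≤ a n := ha0.trans (ha (Nat.zero_le n))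
  have h2 : |a n * ∑ k ∈ range (n + 1), X k| ≤ a n * B := by
    rw [abs_mul, abs_of_nonneg han]
    exact mul_le_mul_of_nonneg_left (hB _ le_rfl) han
  have h3 := abs_add_le (∑ k ∈ range (n + 1), a k * X k - a n * ∑ k ∈ range (n + 1), X k)
    (a n * ∑ k ∈ range (n + 1), X k)
  rw [sub_add_cancel] at h3
  nlinarith [mul_nonneg ha0 hB0]

open Finset in
theorem sum_mul_sq_sub_sq_le {h y : ℕ → ℝ} (hh : Monotone h) {D : ℝ} {n : ℕ}
    (h0 : 0 ≤ h 0) (hy : ∀ t ≤ n + 1, |y t| ≤ D) :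
    ∑ t ∈ range (n + 1), h t * (y t ^ 2 - y (t + 1) ^ 2) ≤ h n * D ^ 2 := by
  have hsq : ∀ t ≤ n + 1, y t ^ 2 ≤ D ^ 2 := fun t ht =>
    sq_le_sq' (neg_le_of_abs_le (hy t ht)) (le_of_abs_le (hy t ht))
  have key : ∀ j ≤ n, ∑ t ∈ range (j + 1), h t * (y t ^ 2 - y (t + 1) ^ 2) ≤
      h j * (D ^ 2 - y (j + 1) ^ 2) := by
    intro j
    induction j with
    | zero =>
      intro _
      simp only [zero_add, sum_range_one]
      exact mul_le_mul_of_nonneg_left (by linarith [hsq 0 (by omega)]) h0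
    | succ j ih =>
      intro hj
      rw [sum_range_succ]
      have := mul_nonneg (sub_nonneg.2 (hh j.le_succ)) (sub_nonneg.2 (hsq (j + 1) (by omega)))
      simp only [Nat.succ_eq_add_one] at this
      linarith [ih (by omega)]
  have hn : 0 ≤ h n := h0.trans (hh (Nat.zero_le n))
  nlinarith [key n le_rfl, sq_nonneg (y (n + 1))]

/-! ### Gradient scales and the regret in one coordinate -/

theorem div_sqrt_add_le {a b : ℝ} (ha : 0 ≤ a) (hb : 0 ≤ b) :
    b / √(a + b) ≤ 2 * (√(a + b) - √a) := by
  have hm : √a ≤ √(a + b) := Real.sqrt_le_sqrt (by linarith)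
  rcases (Real.sqrt_nonneg (a + b)).eq_or_lt with h | h
  · rw [← h] at hm ⊢
    simp [le_antisymm hm (Real.sqrt_nonneg a)]
  · rw [div_le_iff₀ h]
    have h1 := Real.sq_sqrt ha
    have h2 := Real.sq_sqrt (add_nonneg ha hb)
    nlinarith [Real.sqrt_nonneg a]

open Finset in
theorem sum_sq_div_sqrt_sum_sq_le (g : ℕ → ℝ) (n : ℕ) :
    ∑ t ∈ range n, g t ^ 2 / √(∑ k ∈ range (t + 1), g k ^ 2) ≤ 2 * √(∑ k ∈ range n, g k ^ 2) := by
  induction n with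
  | zero => simp
  | succ n ih =>
    rw [sum_range_succ]
    have := div_sqrt_add_le (sum_nonneg fun k (_ : k ∈ range n) => sq_nonneg (g k)) (sq_nonneg (g n))
    rw [← sum_range_succ] at this
    linarith

open Finset in
theorem sum_one_div_sqrt_le (n : ℕ) : ∑ t ∈ range n, 1 / √((t : ℝ) + 1) ≤ 2 * √n := by
  induction n with
  | zero => simp
  | succ n ih =>
    rw [sum_range_succ]
    have := div_sqrt_add_le (Nat.cast_nonneg n) zero_le_one
    push_cast
    linarith

/-- What the regret bound uses of the scale `s` of the entries `g` of the gradients. -/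
structure IsGradScale (κ : ℝ) (g s : ℕ → ℝ) : Prop where
  mono : Monotone s
  nonneg : ∀ t, 0 ≤ s t
  abs_le : ∀ t, |g t| ≤ κ * s t
  sum_sq_le : ∀ t, ∑ k ∈ Finset.range (t + 1), g k ^ 2 ≤ κ * s t ^ 2
  sum_div_le : ∀ n, ∑ t ∈ Finset.range (n + 1), g t ^ 2 / s t ≤ 2 * κ * s n

open Finset in
theorem isGradScale_sqrt_sum {κ : ℝ} (hκ : 1 ≤ κ) (g : ℕ → ℝ) :
    IsGradScale κ g fun t => √(∑ k ∈ range (t + 1), g k ^ 2) where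
  mono := fun a b hab => Real.sqrt_le_sqrt <|
    sum_le_sum_of_subset_of_nonneg (range_subset_range.2 (by omega)) fun _ _ _ => sq_nonneg _
  nonneg t := Real.sqrt_nonneg _
  abs_le t := by
    have h1 : |g t| ≤ √(∑ k ∈ range (t + 1), g k ^ 2) := Real.abs_le_sqrt <|
      single_le_sum (f := fun k => g k ^ 2) (fun _ _ => sq_nonneg _) (self_mem_range_succ t)
    nlinarith [Real.sqrt_nonneg (∑ k ∈ range (t + 1), g k ^ 2)]
  sum_sq_le t := by
    have h : 0 ≤ ∑ k ∈ range (t + 1), g k ^ 2 := sum_nonneg fun _ _ => sq_nonneg _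
    rw [Real.sq_sqrt h]
    nlinarith
  sum_div_le n := by
    have := sum_sq_div_sqrt_sum_sq_le g (n + 1)
    nlinarith [Real.sqrt_nonneg (∑ k ∈ range (n + 1), g k ^ 2)]

theorem AdamPP.le_runMax (a : ℕ → ℝ) {k t : ℕ} (h : k ≤ t) : a k ≤ AdamPP.runMax a t :=
  Finset.le_sup' a (Finset.mem_range_succ_iff.2 h)

theorem AdamPP.runMax_le {a : ℕ → ℝ} {t : ℕ} {c : ℝ} (h : ∀ k ≤ t, a k ≤ c) :
    AdamPP.runMax a t ≤ c :=
  Finset.sup'_le _ _ fun k hk => h k (Finset.mem_range_succ_iff.1 hk)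

theorem AdamPP.runMax_mono (a : ℕ → ℝ) : Monotone (AdamPP.runMax a) := fun _ _ h =>
  AdamPP.runMax_le fun _ hk => AdamPP.le_runMax a (hk.trans h)

open Finset in
-- The running maximum times `κ` dominates every past `g k ^ 2`, and the factor `t + 1` turns this
-- into a bound on their sum. In the last field `max v` is replaced by its final value, which leaves
-- `∑ 1/√(t+1) ≤ 2√(n+1)`.
theorem isGradScale_sqrt_mul_runMax {κ β : ℝ} (hβ : β < 1) (hκ : κ = (1 - β)⁻¹)
    (hκ1 : 1 ≤ κ) {g v : ℕ → ℝ}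
    (hgv : ∀ t, (1 - β) * g t ^ 2 ≤ v t) :
    IsGradScale κ g fun t => √(((t : ℝ) + 1) * AdamPP.runMax v t) := by
  have hβ' : 0 < 1 - β := by linarith
  have hg : ∀ {k t}, k ≤ t → g k ^ 2 ≤ κ * AdamPP.runMax v t := by
    intro k t hkt
    have := (hgv k).trans (AdamPP.le_runMax v hkt)
    rw [hκ, ← div_eq_inv_mul, le_div_iff₀ hβ']
    linarith
  have hr : ∀ t, 0 ≤ AdamPP.runMax v t := fun t => by
    have := (hgv t).trans (AdamPP.le_runMax v le_rfl)
    exact (mul_nonneg hβ'.le (sq_nonneg _)).trans this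
  have hmono : Monotone fun t : ℕ => √(((t : ℝ) + 1) * AdamPP.runMax v t) := fun a b hab =>
    Real.sqrt_le_sqrt <| mul_le_mul (by gcongr) (AdamPP.runMax_mono v hab) (hr a) (by positivity)
  refine ⟨hmono, fun t => Real.sqrt_nonneg _, fun t => ?_, fun t => ?_, fun n => ?_⟩
  · have h1 := hg (le_refl t)
    refine abs_le_of_sq_le_sq ?_ (by positivity)
    rw [mul_pow, Real.sq_sqrt (mul_nonneg (by positivity) (hr t))]
    have h2 : 0 ≤ (t : ℝ) := Nat.cast_nonneg t
    calc _ ≤ κ * AdamPP.runMax v t := h1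
      _ ≤ κ ^ 2 * ((t + 1) * AdamPP.runMax v t) := by
        refine mul_le_mul (by nlinarith) (by nlinarith [hr t]) (hr t) (by positivity)
  · rw [Real.sq_sqrt (mul_nonneg (by positivity) (hr t))]
    calc _ ≤ ∑ k ∈ range (t + 1), κ * AdamPP.runMax v t :=
          sum_le_sum fun k hk => hg (mem_range_succ_iff.1 hk)
      _ = _ := by simp; ring
  · have h1 : ∀ t ∈ range (n + 1), g t ^ 2 / √(((t : ℝ) + 1) * AdamPP.runMax v t) ≤
        κ * √(AdamPP.runMax v n) * (1 / √((t : ℝ) + 1)) := by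
      intro t ht
      have hr' := Real.sqrt_le_sqrt (AdamPP.runMax_mono v (mem_range_succ_iff.1 ht))
      have ht' : 0 < √((t : ℝ) + 1) := Real.sqrt_pos.2 (by positivity)
      rw [Real.sqrt_mul (by positivity), mul_one_div, mul_comm √((t : ℝ) + 1), ← div_div]
      refine div_le_div_of_nonneg_right ?_ ht'.le
      refine div_le_of_le_mul₀ (Real.sqrt_nonneg _) (by positivity) ?_
      refine (hg le_rfl).trans ?_
      rw [mul_assoc]
      refine mul_le_mul_of_nonneg_left ?_ (by linarith)
      nth_rewrite 1 [← Real.mul_self_sqrt (hr t)]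
      exact mul_le_mul_of_nonneg_right hr' (Real.sqrt_nonneg _)
    refine (sum_le_sum h1).trans ?_
    rw [← mul_sum]
    have h2 := sum_one_div_sqrt_le (n + 1)
    push_cast at h2
    rw [Real.sqrt_mul (by positivity)]
    have := mul_le_mul_of_nonneg_left h2
      (mul_nonneg (by linarith : 0 ≤ κ) (Real.sqrt_nonneg (AdamPP.runMax v n)))
    linarith

namespace IsGradScale

variable {κ : ℝ} {g s : ℕ → ℝ}

theorem abs_momentum_le (hs : IsGradScale κ g s) (hκ : 0 ≤ κ) {m b : ℕ → ℝ} (hb0 : ∀ t, 0 ≤ b t)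
    (hb1 : ∀ t, b t ≤ 1)
    (hm0 : m 0 = (1 - b 0) * g 0) (hm : ∀ t, m (t + 1) = b (t + 1) * m t + (1 - b (t + 1)) * g (t + 1))
    (t : ℕ) : |m t| ≤ κ * s t := by
  induction t with
  | zero =>
    rw [hm0, abs_mul, abs_of_nonneg (by linarith [hb1 0])]
    nlinarith [hs.abs_le 0, abs_nonneg (g 0), hb0 0]
  | succ t ih =>
    have h1 := mul_le_mul_of_nonneg_left (hs.mono t.le_succ) hκ
    rw [hm]
    refine (abs_add_le _ _).trans ?_
    rw [abs_mul, abs_mul, abs_of_nonneg (hb0 _), abs_of_nonneg (sub_nonneg.2 (hb1 _))]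
    have h2 := mul_le_mul_of_nonneg_left (ih.trans h1) (hb0 (t + 1))
    have h3 := mul_le_mul_of_nonneg_left (hs.abs_le (t + 1)) (sub_nonneg.2 (hb1 (t + 1)))
    simp only [Nat.succ_eq_add_one] at *
    linarith

open Finset in
-- By convexity of the square, `m_{t+1}² ≤ β m_t² + g_{t+1}²`. Dividing by the nondecreasing `h`
-- gives a contracting recursion for `m_t² / h_t`. Where `h t = 0`, both `m t` and `g t` vanish, so
-- division by zero does no harm.
theorem sum_sq_momentum_div_le (hs : IsGradScale κ g s) (hκ : 0 ≤ κ) {m b h : ℕ → ℝ} {β : ℝ}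
    (hβ : β < 1) (hb0 : ∀ t, 0 ≤ b t) (hb1 : ∀ t, b t ≤ β)
    (hm0 : m 0 = (1 - b 0) * g 0) (hm : ∀ t, m (t + 1) = b (t + 1) * m t + (1 - b (t + 1)) * g (t + 1))
    (hh : Monotone h) (hsh : ∀ t, s t ≤ h t) (n : ℕ) :
    ∑ t ∈ range (n + 1), m t ^ 2 / h t ≤ 2 * κ / (1 - β) * s n := by
  have hh0 : ∀ t, 0 ≤ h t := fun t => (hs.nonneg t).trans (hsh t)
  have hβ' : ∀ t, b t ≤ 1 := fun t => (hb1 t).trans hβ.le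
  have hβ0 : 0 ≤ β := (hb0 0).trans (hb1 0)
  have hgs : ∀ t, g t ^ 2 / h t ≤ g t ^ 2 / s t := by
    intro t
    rcases (hs.nonneg t).eq_or_lt with h0 | h0
    · have := hs.abs_le t
      rw [← h0, mul_zero] at this
      simp [abs_nonpos_iff.1 this]
    · exact div_le_div_of_nonneg_left (sq_nonneg _) h0 (hsh t)
  have hmh : ∀ t, m t ^ 2 / h (t + 1) ≤ m t ^ 2 / h t := by
    intro t
    rcases (hh0 t).eq_or_lt with h0 | h0
    · have h1 := hs.abs_momentum_le hκ hb0 hβ' hm0 hm t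
      have h2 : s t = 0 := le_antisymm (h0 ▸ hsh t) (hs.nonneg t)
      rw [h2, mul_zero] at h1
      simp [abs_nonpos_iff.1 h1]
    · exact div_le_div_of_nonneg_left (sq_nonneg _) h0 (hh t.le_succ)
  have hstep : ∀ t, m (t + 1) ^ 2 / h (t + 1) ≤ β * (m t ^ 2 / h t) + g (t + 1) ^ 2 / s (t + 1) := by
    intro t
    have hb := hb0 (t + 1)
    have hbb := hβ' (t + 1)
    have h1 : m (t + 1) ^ 2 ≤ β * m t ^ 2 + g (t + 1) ^ 2 := by
      rw [hm]
      have h2 : (b (t + 1) * m t + (1 - b (t + 1)) * g (t + 1)) ^ 2 ≤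
          b (t + 1) * m t ^ 2 + (1 - b (t + 1)) * g (t + 1) ^ 2 := by
        nlinarith [mul_nonneg (mul_nonneg hb (sub_nonneg.2 hbb)) (sq_nonneg (m t - g (t + 1)))]
      nlinarith [sq_nonneg (m t), sq_nonneg (g (t + 1)), hb1 (t + 1)]
    calc _ ≤ (β * m t ^ 2 + g (t + 1) ^ 2) / h (t + 1) := div_le_div_of_nonneg_right h1 (hh0 _)
      _ = β * (m t ^ 2 / h (t + 1)) + g (t + 1) ^ 2 / h (t + 1) := by ring
      _ ≤ _ := add_le_add (mul_le_mul_of_nonneg_left (hmh t) hβ0) (hgs _)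
  have hzero : m 0 ^ 2 / h 0 ≤ g 0 ^ 2 / s 0 := by
    refine le_trans ?_ (hgs 0)
    refine div_le_div_of_nonneg_right ?_ (hh0 0)
    rw [hm0, mul_pow]
    have : (1 - b 0) ^ 2 ≤ 1 := by nlinarith [hb0 0, hβ' 0]
    nlinarith [sq_nonneg (g 0)]
  -- The recursion uses only the terms before the last, hence the subtraction. Dropping it and
  -- solving for the sum gives the factor `1 / (1 - β)`.
  have key : ∀ n, ∑ t ∈ range (n + 1), m t ^ 2 / h t ≤
      β * ∑ t ∈ range (n + 1), m t ^ 2 / h t + ∑ t ∈ range (n + 1), g t ^ 2 / s t -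
        β * (m n ^ 2 / h n) := by
    intro n
    induction n with
    | zero => simpa using hzero
    | succ n ih =>
      rw [sum_range_succ, sum_range_succ (fun t => g t ^ 2 / s t)]
      linarith [hstep n]
  have h1 := key n
  have h2 : 0 ≤ β * (m n ^ 2 / h n) := mul_nonneg hβ0 (div_nonneg (sq_nonneg _) (hh0 n))
  rw [div_mul_eq_mul_div, le_div_iff₀ (by linarith)]
  linarith [hs.sum_div_le n]

open Finset in
/-- The regret of the adaptive step `y ↦ y - η m / h` in one coordinate. -/
theorem regret_le (hs : IsGradScale κ g s) (hκ : 0 ≤ κ) {m h y η : ℕ → ℝ} {β lam D : ℝ}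
    (hβ0 : 0 ≤ β) (hβ : β < 1) (hlam0 : 0 ≤ lam) (hlam : lam < 1)
    (hm0 : m 0 = (1 - β * lam ^ 0) * g 0)
    (hm : ∀ t, m (t + 1) = β * lam ^ (t + 1) * m t + (1 - β * lam ^ (t + 1)) * g (t + 1))
    (hh : Monotone h) (hsh : ∀ t, s t ≤ h t) (hy : ∀ t, y (t + 1) = y t - η t * (m t / h t))
    (hη : Monotone η) (hη0 : 0 ≤ η 0) {n : ℕ} (hD : ∀ t ≤ n + 1, |y t| ≤ D) :
    2 * ∑ t ∈ range (n + 1), η t * (g t * y t) ≤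
      h n * D ^ 2 + (2 * κ / (1 - β) * η n ^ 2 + 4 * κ / (1 - lam) * (η n * D)) * s n := by
  have hpow : ∀ t, lam ^ t ≤ 1 := fun t => pow_le_one₀ hlam0 hlam.le
  have hb0 : ∀ t, 0 ≤ β * lam ^ t := fun t => by positivity
  have hb1 : ∀ t, β * lam ^ t ≤ β := fun t => mul_le_of_le_one_right hβ0 (hpow t)
  have hb1' : ∀ t, β * lam ^ t ≤ 1 := fun t => (hb1 t).trans hβ.le
  have hη' : ∀ t, 0 ≤ η t := fun t => hη0.trans (hη (Nat.zero_le t))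
  have hmabs := hs.abs_momentum_le hκ hb0 hb1' hm0 hm
  have hD0 : 0 ≤ D := (abs_nonneg _).trans (hD 0 (by omega))
  have hmh : ∀ t, h t = 0 → m t = 0 := by
    intro t h0
    have h1 := hmabs t
    have h2 : s t = 0 := le_antisymm (h0 ▸ hsh t) (hs.nonneg t)
    rw [h2, mul_zero] at h1
    exact abs_nonpos_iff.1 h1
  -- For `t > 0`, `g_t - m_t = β λ^t (g_t - m_{t-1})`, and both terms in the difference are at most
  -- `κ s_n`.
  have hdiff : ∀ t ≤ n, |g t - m t| ≤ lam ^ t * (2 * κ * s n) := by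
    intro t ht
    have hsn := mul_le_mul_of_nonneg_left (hs.mono ht) hκ
    have hlt : 0 ≤ lam ^ t := pow_nonneg hlam0 t
    cases t with
    | zero =>
      rw [hm0, pow_zero, show g 0 - (1 - β * 1) * g 0 = β * g 0 by ring, abs_mul, abs_of_nonneg hβ0]
      nlinarith [hs.abs_le 0, abs_nonneg (g 0)]
    | succ t =>
      rw [hm, show g (t + 1) - (β * lam ^ (t + 1) * m t + (1 - β * lam ^ (t + 1)) * g (t + 1)) =
        lam ^ (t + 1) * (β * (g (t + 1) - m t)) by ring, abs_mul, abs_of_nonneg hlt]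
      refine mul_le_mul_of_nonneg_left ?_ hlt
      rw [abs_mul, abs_of_nonneg hβ0]
      have h1 : |g (t + 1) - m t| ≤ 2 * κ * s n := by
        have h2 := mul_le_mul_of_nonneg_left (hs.mono (show t ≤ n by omega)) hκ
        linarith [abs_sub (g (t + 1)) (m t), hs.abs_le (t + 1), hmabs t]
      exact (mul_le_of_le_one_left (abs_nonneg _) hβ.le).trans h1
  have hterm : ∀ t ∈ range (n + 1), 2 * (η t * (g t * y t)) ≤
      h t * (y t ^ 2 - y (t + 1) ^ 2) + η n ^ 2 * (m t ^ 2 / h t) +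
        lam ^ t * (4 * κ * s n * (η n * D)) := by
    intro t ht
    have ht' : t ≤ n := mem_range_succ_iff.1 ht
    -- This is the square of the update, expanded. If `h t = 0`, then `m t = 0` and both sides
    -- vanish.
    have h1 : 2 * (η t * (m t * y t)) = h t * (y t ^ 2 - y (t + 1) ^ 2) + η t ^ 2 * (m t ^ 2 / h t) := by
      rcases eq_or_ne (h t) 0 with h0 | h0
      · simp [h0, hmh t h0]
      · rw [hy]; field_simp; ring
    have h2 : η t ^ 2 * (m t ^ 2 / h t) ≤ η n ^ 2 * (m t ^ 2 / h t) :=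
      mul_le_mul_of_nonneg_right (pow_le_pow_left₀ (hη' t) (hη ht') 2)
        (div_nonneg (sq_nonneg _) ((hs.nonneg t).trans (hsh t)))
    have h3 : η t * ((g t - m t) * y t) ≤ η n * (lam ^ t * (2 * κ * s n) * D) := by
      have h4 : (g t - m t) * y t ≤ lam ^ t * (2 * κ * s n) * D := by
        refine (le_abs_self _).trans ?_
        rw [abs_mul]
        exact mul_le_mul (hdiff t ht') (hD t (by omega)) (abs_nonneg _)
          ((abs_nonneg _).trans (hdiff t ht'))
      have h5 : 0 ≤ lam ^ t * (2 * κ * s n) * D :=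
        mul_nonneg ((abs_nonneg _).trans (hdiff t ht')) hD0
      exact (mul_le_mul_of_nonneg_left h4 (hη' t)).trans (mul_le_mul_of_nonneg_right (hη ht') h5)
    linarith
  have hgeom : ∑ t ∈ range (n + 1), lam ^ t ≤ 1 / (1 - lam) := by
    rw [one_div, ← tsum_geometric_of_lt_one hlam0 hlam]
    exact (summable_geometric_of_lt_one hlam0 hlam).sum_le_tsum _ fun t _ => pow_nonneg hlam0 t
  rw [mul_sum]
  refine (sum_le_sum hterm).trans ?_
  rw [sum_add_distrib, sum_add_distrib, ← mul_sum, ← sum_mul]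
  have h1 := sum_mul_sq_sub_sq_le hh ((hs.nonneg 0).trans (hsh 0)) hD
  have h2 := mul_le_mul_of_nonneg_left
    (hs.sum_sq_momentum_div_le hκ hβ hb0 hb1 hm0 hm hh hsh n) (sq_nonneg (η n))
  have h3 : 0 ≤ 4 * κ * s n * (η n * D) :=
    mul_nonneg (mul_nonneg (by positivity) (hs.nonneg n)) (mul_nonneg (hη' n) hD0)
  have h4 := mul_le_mul_of_nonneg_right hgeom h3
  have h5 : 4 * κ / (1 - lam) * (η n * D) * s n = 1 / (1 - lam) * (4 * κ * s n * (η n * D)) := by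
    ring
  linarith

end IsGradScale

/-! ### A time-uniform empirical Bernstein inequality -/

/-- This makes the observed square `x ^ 2` a compensator: the right side is linear in `x`, so its
conditional mean involves only that of `x`. It follows from `log (1 + x) ≥ x / (1 + x)` and `1 + 2 x
≥ 0`. -/
theorem Real.exp_sub_two_mul_sq_le {x : ℝ} (hx : |x| ≤ 1 / 2) :
    Real.exp (x - 2 * x ^ 2) ≤ 1 + x := by
  have h := neg_le_of_abs_le hx
  have h1 : 0 < 1 + x := by linarith
  rw [← Real.le_log_iff_exp_le h1]
  refine le_trans ?_ (Real.one_sub_inv_le_log_of_pos h1)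
  rw [show 1 - (1 + x)⁻¹ = x / (1 + x) by field_simp; ring, le_div_iff₀ h1]
  nlinarith [sq_nonneg x]

theorem AdamPP.one_le_theta {t : ℕ} (ht : 1 ≤ t) {δ : ℝ} (hδ : 0 < δ) (hδ1 : δ < 1) : 1 ≤ AdamPP.theta t δ := by
  have ht' : (1 : ℝ) ≤ t := by exact_mod_cast ht
  have hlog6 : (1 : ℝ) ≤ Real.log (6 * t) := by
    rw [Real.le_log_iff_exp_le (by positivity)]
    linarith [Real.exp_one_lt_d9]
  have harg : 60 * Real.log (6 * t) ≤ 60 * Real.log (6 * t) / δ :=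
    le_div_self (by positivity) hδ hδ1.le
  rw [AdamPP.theta, Real.le_log_iff_exp_le (by positivity)]
  linarith [Real.exp_one_lt_d9]

theorem AdamPP.theta_mono {s t : ℕ} (hs : 1 ≤ s) (hst : s ≤ t) {δ : ℝ} (hδ : 0 < δ) :
    AdamPP.theta s δ ≤ AdamPP.theta t δ := by
  have hs' : (1 : ℝ) ≤ s := by exact_mod_cast hs
  have hst' : (s : ℝ) ≤ t := by exact_mod_cast hst
  have hlog6 : 0 < Real.log (6 * s) := Real.log_pos (by linarith)
  refine Real.log_le_log (by positivity) ?_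
  gcongr

section Concentration

variable {Ω : Type*} {mΩ : MeasurableSpace Ω} {μ : Measure Ω} [IsProbabilityMeasure μ]
  {ℱ : Filtration ℕ mΩ} {Z : ℕ → Ω → ℝ} {L : ℝ}

open scoped Classical in
-- The product is a supermartingale: with `p` the conditional mean of `Z`, `𝔼[exp (cZ - 2c²Z²) | ℱ]
-- ≤ 1 + c p ≤ exp (c p)`. The sets `A k` switch factors off, so that the product can be stopped at
-- a random time.
theorem integral_prod_exp_le_one (hZ : ∀ k, Measurable[ℱ (k + 1)] (Z k))
    (hL : ∀ k, ∀ᵐ ω ∂μ, |Z k ω| ≤ L) {c : ℝ} (hc : |c| * L ≤ 1 / 2)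
    {A : ℕ → Set Ω} (hA : ∀ k, MeasurableSet[ℱ k] (A k)) (n : ℕ) :
    Integrable (fun ω => ∏ k ∈ Finset.range n, (if ω ∈ A k then
      Real.exp (c * (Z k ω - (μ[Z k | ℱ k]) ω) - 2 * (c * Z k ω) ^ 2) else 1)) μ ∧
    ∫ ω, ∏ k ∈ Finset.range n, (if ω ∈ A k then
      Real.exp (c * (Z k ω - (μ[Z k | ℱ k]) ω) - 2 * (c * Z k ω) ^ 2) else 1) ∂μ ≤ 1 := by
  have hcZ : ∀ k, ∀ᵐ ω ∂μ, |c * Z k ω| ≤ 1 / 2 := fun k => by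
    filter_upwards [hL k] with ω hω
    rw [abs_mul]
    exact (mul_le_mul_of_nonneg_left hω (abs_nonneg c)).trans hc
  have hp : ∀ k, ∀ᵐ ω ∂μ, |c * (μ[Z k | ℱ k]) ω| ≤ 1 / 2 := fun k => by
    filter_upwards [ae_bdd_abs_condExp_of_ae_bdd_abs (m := ℱ k) (hL k)] with ω hω
    rw [abs_mul]
    exact (mul_le_mul_of_nonneg_left hω (abs_nonneg c)).trans hc
  have hpm : ∀ k, Measurable[ℱ k] (μ[Z k | ℱ k]) := fun k => stronglyMeasurable_condExp.measurable
  set N : ℕ → Ω → ℝ := fun n ω => ∏ k ∈ Finset.range n, (if ω ∈ A k then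
      Real.exp (c * (Z k ω - (μ[Z k | ℱ k]) ω) - 2 * (c * Z k ω) ^ 2) else 1) with hN
  have hNm : ∀ n, Measurable[ℱ n] (N n) := by
    intro n
    refine Finset.measurable_fun_prod _ fun k hk => ?_
    have hk' : k + 1 ≤ n := Finset.mem_range.1 hk
    have h1 : Measurable[ℱ n] (Z k) := (hZ k).mono (ℱ.mono hk') le_rfl
    have h2 : Measurable[ℱ n] (μ[Z k | ℱ k]) := (hpm k).mono (ℱ.mono (by omega)) le_rfl
    refine Measurable.ite (ℱ.mono (by omega : k ≤ n) _ (hA k)) ?_ measurable_const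
    exact Real.measurable_exp.comp
      (((h1.sub h2).const_mul c).sub (((h1.const_mul c).pow_const 2).const_mul 2))
  have hN0 : ∀ n ω, 0 ≤ N n ω := fun n ω => Finset.prod_nonneg fun k _ => by
    split_ifs <;> positivity
  have hNb : ∀ n, ∀ᵐ ω ∂μ, N n ω ≤ Real.exp 1 ^ n := by
    intro n
    filter_upwards [ae_all_iff.2 hcZ, ae_all_iff.2 hp] with ω h1 h2
    refine (Finset.prod_le_prod (g := fun _ => Real.exp 1)
      (fun k _ => by split_ifs <;> positivity) fun k _ => ?_).trans_eq (by simp)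
    split_ifs
    · refine Real.exp_le_exp.2 ?_
      nlinarith [le_of_abs_le (h1 k), neg_le_of_abs_le (h2 k), sq_nonneg (c * Z k ω)]
    · exact Real.one_le_exp zero_le_one
  have hNm' : ∀ n, Measurable (N n) := fun n => (hNm n).mono (ℱ.le n) le_rfl
  have hNi : ∀ n, Integrable (N n) μ := fun n => by
    refine Integrable.of_bound (hNm' n).aestronglyMeasurable (Real.exp 1 ^ n) ?_
    filter_upwards [hNb n] with ω hω
    rwa [Real.norm_of_nonneg (hN0 n ω)]
  refine ⟨hNi n, ?_⟩
  induction n with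
  | zero => simp
  | succ n ih =>
    refine le_trans ?_ ih
    change ∫ ω, N (n + 1) ω ∂μ ≤ ∫ ω, N n ω ∂μ
    have hAn : MeasurableSet (A n) := ℱ.le n _ (hA n)
    -- `W` collects everything in the next product that is known at time `n` on `A n`, so `Z n` may
    -- be replaced by its conditional mean in the integral of `W * Z n`.
    set W : Ω → ℝ := fun ω => (A n).indicator (fun ω => N n ω * Real.exp (-(c * (μ[Z n | ℱ n]) ω))) ω
      with hW
    have hWm : Measurable[ℱ n] W :=
      ((hNm n).mul (Real.measurable_exp.comp ((hpm n).const_mul c).neg)).indicator (hA n)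
    have hWb : ∀ᵐ ω ∂μ, ‖W ω‖ ≤ Real.exp 1 ^ n * Real.exp 1 := by
      filter_upwards [hNb n, hp n] with ω h1 h2
      by_cases hω : ω ∈ A n
      · simp only [hW, Set.indicator_of_mem hω, Real.norm_eq_abs, abs_mul, abs_of_nonneg (hN0 n ω),
          Real.abs_exp]
        gcongr
        linarith [neg_le_of_abs_le h2]
      · simp only [hW, Set.indicator_of_notMem hω, norm_zero]
        positivity
    have hZi : Integrable (Z n) μ := Integrable.of_bound
      ((hZ n).mono (ℱ.le _) le_rfl).aestronglyMeasurable L (by simpa using hL n)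
    have hWm' : Measurable W := hWm.mono (ℱ.le n) le_rfl
    have hWi : Integrable W μ := Integrable.of_bound hWm'.aestronglyMeasurable _ hWb
    have hWZ : Integrable (W * Z n) μ := hZi.bdd_mul hWm'.aestronglyMeasurable hWb
    have hWp : Integrable (W * μ[Z n | ℱ n]) μ :=
      integrable_condExp.bdd_mul hWm'.aestronglyMeasurable hWb
    have hpull : ∫ ω, (W * Z n) ω ∂μ = ∫ ω, (W * μ[Z n | ℱ n]) ω ∂μ := by
      rw [← integral_condExp (ℱ.le n)]
      exact integral_congr_ae
        (condExp_mul_of_stronglyMeasurable_left hWm.stronglyMeasurable hWZ hZi)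
    have hNc : Integrable (fun ω => (A n)ᶜ.indicator (N n) ω) μ := (hNi n).indicator hAn.compl
    have hNA : Integrable (fun ω => (A n).indicator (N n) ω) μ := (hNi n).indicator hAn
    have hWZ' : Integrable (fun ω => W ω + c * (W * Z n) ω) μ := hWi.add (hWZ.const_mul c)
    have hWp' : Integrable (fun ω => W ω + c * (W * μ[Z n | ℱ n]) ω) μ :=
      hWi.add (hWp.const_mul c)
    have hstep : ∀ᵐ ω ∂μ, N (n + 1) ω ≤ W ω + c * (W * Z n) ω + (A n)ᶜ.indicator (N n) ω := by
      filter_upwards [hcZ n] with ω h1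
      have hs : N (n + 1) ω = N n ω * (if ω ∈ A n then
        Real.exp (c * (Z n ω - (μ[Z n | ℱ n]) ω) - 2 * (c * Z n ω) ^ 2) else 1) :=
          Finset.prod_range_succ _ _
      by_cases hω : ω ∈ A n
      · have hω' : ω ∉ (A n)ᶜ := fun h => h hω
        rw [hs, if_pos hω, Set.indicator_of_notMem hω']
        simp only [Pi.mul_apply, hW, Set.indicator_of_mem hω]
        have h2 := Real.exp_sub_two_mul_sq_le h1
        rw [show c * (Z n ω - (μ[Z n | ℱ n]) ω) - 2 * (c * Z n ω) ^ 2 =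
          (c * Z n ω - 2 * (c * Z n ω) ^ 2) + -(c * (μ[Z n | ℱ n]) ω) by ring, Real.exp_add]
        have h3 := mul_le_mul_of_nonneg_right h2
          (mul_nonneg (hN0 n ω) (Real.exp_pos (-(c * (μ[Z n | ℱ n]) ω))).le)
        linarith
      · have hω' : ω ∈ (A n)ᶜ := hω
        rw [hs, if_neg hω, Set.indicator_of_mem hω']
        simp [hW, Set.indicator_of_notMem hω]
    have hback : ∀ᵐ ω ∂μ, W ω + c * (W * μ[Z n | ℱ n]) ω ≤ (A n).indicator (N n) ω := by
      filter_upwards with ω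
      by_cases hω : ω ∈ A n
      · simp only [Pi.mul_apply, hW, Set.indicator_of_mem hω]
        set q := c * (μ[Z n | ℱ n]) ω with hq
        have h1 : (1 + q) * Real.exp (-q) ≤ 1 := by
          rw [Real.exp_neg, ← div_eq_mul_inv, div_le_one (Real.exp_pos q)]
          linarith [Real.add_one_le_exp q]
        calc _ = N n ω * ((1 + q) * Real.exp (-q)) := by rw [hq]; ring
          _ ≤ N n ω := mul_le_of_le_one_right (hN0 n ω) h1
      · simp [hW, Set.indicator_of_notMem hω]
    calc ∫ ω, N (n + 1) ω ∂μ
        ≤ ∫ ω, (W ω + c * (W * Z n) ω + (A n)ᶜ.indicator (N n) ω) ∂μ :=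
          integral_mono_ae (hNi _) (hWZ'.add hNc) hstep
      _ = ∫ ω, (W ω + c * (W * μ[Z n | ℱ n]) ω) ∂μ + ∫ ω, (A n)ᶜ.indicator (N n) ω ∂μ := by
          rw [integral_add hWZ' hNc, integral_add hWi (hWZ.const_mul c),
            integral_add hWi (hWp.const_mul c), integral_const_mul, integral_const_mul, hpull]
      _ ≤ ∫ ω, (A n).indicator (N n) ω ∂μ + ∫ ω, (A n)ᶜ.indicator (N n) ω ∂μ := by
          exact add_le_add (integral_mono_ae hWp' hNA hback) le_rfl
      _ = ∫ ω, N n ω ∂μ := by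
          rw [← integral_add hNA hNc]
          exact integral_congr_ae (Filter.Eventually.of_forall fun ω =>
            Set.indicator_self_add_compl_apply (A n) (N n) ω)

open scoped Classical in
/-- A maximal inequality for the sums of the centred `Z k`, normalized by the sum of squares. -/
theorem measureReal_exists_le_sum_le (hZ : ∀ k, Measurable[ℱ (k + 1)] (Z k))
    (hL : ∀ k, ∀ᵐ ω ∂μ, |Z k ω| ≤ L) {c : ℝ} (hc : |c| * L ≤ 1 / 2) (a : ℝ) (T : ℕ) :
    μ.real {ω | ∃ t ≤ T, a ≤ c * ∑ k ∈ Finset.range t, (Z k ω - (μ[Z k | ℱ k]) ω) -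
      2 * c ^ 2 * ∑ k ∈ Finset.range t, Z k ω ^ 2} ≤ Real.exp (-a) := by
  set Y : ℕ → Ω → ℝ := fun t ω => c * ∑ k ∈ Finset.range t, (Z k ω - (μ[Z k | ℱ k]) ω) -
      2 * c ^ 2 * ∑ k ∈ Finset.range t, Z k ω ^ 2 with hY
  have hYm : ∀ t, Measurable[ℱ t] (Y t) := by
    intro t
    have h1 : ∀ k ∈ Finset.range t, Measurable[ℱ t] (Z k) := fun k hk =>
      (hZ k).mono (ℱ.mono (Finset.mem_range.1 hk)) le_rfl
    have h2 : ∀ k ∈ Finset.range t, Measurable[ℱ t] (μ[Z k | ℱ k]) := fun k hk =>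
      stronglyMeasurable_condExp.measurable.mono (ℱ.mono (Finset.mem_range.1 hk).le) le_rfl
    exact ((Finset.measurable_fun_sum _ fun k hk => (h1 k hk).sub (h2 k hk)).const_mul c).sub
      ((Finset.measurable_fun_sum _ fun k hk => (h1 k hk).pow_const 2).const_mul _)
  -- The level `a` has not been reached up to time `k`. With these sets the product freezes at the
  -- first crossing, where it is at least `exp a`, and Markov's inequality at the single time `T`
  -- controls all `t ≤ T`.
  set A : ℕ → Set Ω := fun k => {ω | ∀ j ≤ k, Y j ω < a} with hAdef
  have hA : ∀ k, MeasurableSet[ℱ k] (A k) := by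
    intro k
    have : A k = ⋂ j ∈ Set.Iic k, {ω | Y j ω < a} := by ext; simp [hAdef]
    rw [this]
    exact MeasurableSet.biInter (Set.to_countable _) fun j hj =>
      measurableSet_lt ((hYm j).mono (ℱ.mono hj) le_rfl) measurable_const
  have hexp : ∀ t ω, ∏ k ∈ Finset.range t,
      Real.exp (c * (Z k ω - (μ[Z k | ℱ k]) ω) - 2 * (c * Z k ω) ^ 2) = Real.exp (Y t ω) := by
    intro t ω
    rw [← Real.exp_sum, hY]
    simp only [Finset.sum_sub_distrib, Finset.mul_sum, mul_sub]
    congr 2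
    exact Finset.sum_congr rfl fun k _ => by ring
  set N : Ω → ℝ := fun ω => ∏ k ∈ Finset.range T, (if ω ∈ A k then
      Real.exp (c * (Z k ω - (μ[Z k | ℱ k]) ω) - 2 * (c * Z k ω) ^ 2) else 1) with hN
  have hsub : {ω | ∃ t ≤ T, a ≤ Y t ω} ⊆ {ω | Real.exp a ≤ N ω} := by
    rintro ω ⟨t, ht, hat⟩
    have hex : ∃ t, a ≤ Y t ω := ⟨t, hat⟩
    have h0T : Nat.find hex ≤ T := (Nat.find_min' hex hat).trans ht
    have hprod : N ω = Real.exp (Y (Nat.find hex) ω) := by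
      rw [← hexp, hN]
      simp only
      rw [← Finset.prod_subset (Finset.range_subset_range.2 h0T)]
      · refine Finset.prod_congr rfl fun k hk => if_pos fun j hj => ?_
        exact not_le.1 (Nat.find_min hex (hj.trans_lt (Finset.mem_range.1 hk)))
      · intro k _ hk
        refine if_neg fun h => ?_
        exact absurd (Nat.find_spec hex) (not_le.2 (h _ (not_lt.1 fun h' => hk (Finset.mem_range.2 h'))))
    change Real.exp a ≤ N ω
    rw [hprod]
    exact Real.exp_le_exp.2 (Nat.find_spec hex)
  obtain ⟨hNi, hint⟩ : Integrable N μ ∧ ∫ ω, N ω ∂μ ≤ 1 := by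
    convert integral_prod_exp_le_one hZ hL hc hA T
  have hN0 : 0 ≤ᵐ[μ] N := Filter.Eventually.of_forall fun ω => Finset.prod_nonneg fun k _ => by
    split_ifs <;> positivity
  have hmarkov := mul_meas_ge_le_integral_of_nonneg hN0 hNi (Real.exp a)
  rw [Real.exp_neg, ← one_div, le_div_iff₀ (Real.exp_pos a), mul_comm]
  exact (mul_le_mul_of_nonneg_left (measureReal_mono hsub) (Real.exp_pos a).le).trans
    (hmarkov.trans hint)

/-- Combining the maximal inequalities for geometrically spaced parameters. -/
theorem abs_le_sqrt_of_forall_scale {S V δ : ℝ} {t : ℕ} (hL : 0 < L) (hδ : 0 < δ) (hδ1 : δ < 1)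
    (ht : 1 ≤ t) (hV0 : 0 ≤ V) (hV : V ≤ t * L ^ 2)
    (hS : ∀ j : ℕ, j ≤ t → |S| ≤ 2 * (1 / (2 ^ j * (2 * L))) * V +
      Real.log (2 * (j + 1) * (j + 2) / δ) * (2 ^ j * (2 * L))) :
    |S| ≤ 6 * √(AdamPP.theta t δ * V + L ^ 2 * AdamPP.theta t δ ^ 2) := by
  have ht' : (1 : ℝ) ≤ t := by exact_mod_cast ht
  have hlog6 : (1 : ℝ) ≤ Real.log (6 * t) := by
    rw [Real.le_log_iff_exp_le (by positivity)]
    linarith [Real.exp_one_lt_d9]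
  set θ := AdamPP.theta t δ with hθ
  have hθ1 : 1 ≤ θ := AdamPP.one_le_theta ht hδ hδ1
  -- For a small sum of squares the term `L² θ²` covers the bound at scale 0. Otherwise the best
  -- scale `2 ^ j * (2 * L)` is about `√(V / θ)`, which is located within a factor 2.
  rcases le_or_gt V (4 * L ^ 2 * θ) with hV1 | hV1
  · have h := hS 0 (Nat.zero_le t)
    have h1 : Real.log (2 * ((0 : ℕ) + 1) * ((0 : ℕ) + 2) / δ) ≤ θ := by
      refine Real.log_le_log (by positivity) ?_
      refine div_le_div_of_nonneg_right ?_ hδ.le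
      norm_num
      linarith
    have h2 : |S| ≤ V / L + 2 * L * θ := by
      refine h.trans ?_
      rw [pow_zero, one_mul]
      have h3 := mul_le_mul_of_nonneg_right h1 (by positivity : 0 ≤ 2 * L)
      have h4 : 2 * (1 / (2 * L)) * V = V / L := by field_simp
      linarith
    have h3 : V / L ≤ 2 * √(θ * V + L ^ 2 * θ ^ 2) := by
      have h4 : V / L / 2 ≤ √(θ * V + L ^ 2 * θ ^ 2) := by
        refine Real.le_sqrt_of_sq_le ?_
        have h5 : (V / L / 2) ^ 2 = V * V / (4 * L ^ 2) := by field_simp; norm_num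
        have h6 : V * V / (4 * L ^ 2) ≤ θ * V := by
          rw [div_le_iff₀ (by positivity)]
          nlinarith
        rw [h5]
        nlinarith [sq_nonneg (L * θ)]
      linarith
    have h4 : L * θ ≤ √(θ * V + L ^ 2 * θ ^ 2) := by
      refine Real.le_sqrt_of_sq_le ?_
      have : 0 ≤ θ * V := by positivity
      linarith [mul_pow L θ 2]
    linarith [Real.sqrt_nonneg (θ * V + L ^ 2 * θ ^ 2)]
  · replace hV0 : 0 < V := lt_of_le_of_lt (by positivity) hV1
    set w := √(V / θ) / (2 * L) with hw
    have hw1 : 1 ≤ w := by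
      rw [hw, le_div_iff₀ (by positivity), one_mul]
      refine Real.le_sqrt_of_sq_le ?_
      rw [le_div_iff₀ (by positivity)]
      linarith
    obtain ⟨n, hn1, hn2⟩ := exists_nat_pow_near hw1 (one_lt_two : (1 : ℝ) < 2)
    -- Since `V ≤ t L²`, the chosen scale has index logarithmic in `t`. Hence scales up to `t`
    -- suffice, and the union bound costs only the iterated logarithm in `θ`.
    have hwt : 4 ^ (n + 1) ≤ (t : ℝ) := by
      have h1 : ((2 : ℝ) ^ n) ^ 2 ≤ w ^ 2 := pow_le_pow_left₀ (by positivity) hn1 2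
      have h2 : w ^ 2 = V / θ / (4 * L ^ 2) := by
        rw [hw, div_pow, Real.sq_sqrt (by positivity)]; ring
      have h3 : V / θ ≤ t * L ^ 2 := (div_le_self hV0.le hθ1).trans hV
      rw [h2, le_div_iff₀ (by positivity)] at h1
      have h4 : ((2 : ℝ) ^ n) ^ 2 * 4 ≤ t := by
        refine le_of_mul_le_mul_right ?_ (by positivity : 0 < L ^ 2)
        linarith
      calc (4 : ℝ) ^ (n + 1) = ((2 : ℝ) ^ n) ^ 2 * 4 := by
            rw [pow_succ, ← pow_mul, mul_comm n, pow_mul]; norm_num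
        _ ≤ t := h4
    have hnt : n ≤ t := by
      have h1 : n < 4 ^ (n + 1) :=
        (Nat.lt_pow_self (by norm_num)).trans (Nat.pow_lt_pow_right (by norm_num) n.lt_succ_self)
      have h2 : 4 ^ (n + 1) ≤ t := by exact_mod_cast hwt
      omega
    have hlogn : (n : ℝ) + 1 ≤ Real.log (6 * t) := by
      rw [Real.le_log_iff_exp_le (by positivity)]
      have h1 : Real.exp ((n : ℝ) + 1) = Real.exp 1 ^ (n + 1) := by
        rw [← Real.exp_nat_mul]; push_cast; ring_nf
      rw [h1]
      have h2 : Real.exp 1 ^ (n + 1) ≤ (4 : ℝ) ^ (n + 1) :=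
        pow_le_pow_left₀ (Real.exp_pos 1).le (by linarith [Real.exp_one_lt_d9]) _
      linarith
    have ha : Real.log (2 * ((n : ℝ) + 1) * (n + 2) / δ) ≤ 2 * θ := by
      rw [hθ, AdamPP.theta, show (2 : ℝ) = ((2 : ℕ) : ℝ) by norm_num, ← Real.log_pow]
      refine Real.log_le_log (by positivity) ?_
      rw [div_pow, div_le_div_iff₀ hδ (by positivity)]
      have h1 : ((2 : ℕ) : ℝ) * ((n : ℝ) + 1) * (n + (2 : ℕ)) ≤ 4 * Real.log (6 * t) ^ 2 := by
        push_cast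
        nlinarith [(Nat.cast_nonneg n : (0 : ℝ) ≤ n)]
      have h2 : δ ^ 2 ≤ δ := by nlinarith
      calc _ ≤ 4 * Real.log (6 * t) ^ 2 * δ := by
            refine mul_le_mul h1 h2 (by positivity) (by positivity)
        _ ≤ _ := by
          refine mul_le_mul_of_nonneg_right ?_ hδ.le
          rw [mul_pow]
          exact mul_le_mul_of_nonneg_right (by norm_num) (sq_nonneg _)
    have h := hS n hnt
    set r := √(V / θ) with hr
    have hr2 : r ^ 2 = V / θ := Real.sq_sqrt (by positivity)
    have hr0 : 0 < r := Real.sqrt_pos.2 (by positivity)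
    have h1 : 2 ^ n * (2 * L) ≤ r := by
      rwa [hw, le_div_iff₀ (by positivity)] at hn1
    have h2 : 1 / (2 ^ n * (2 * L)) ≤ 2 / r := by
      rw [hw, div_lt_iff₀ (by positivity), pow_succ] at hn2
      rw [div_le_div_iff₀ (by positivity) hr0]
      linarith
    have h3 : V = r ^ 2 * θ := by rw [hr2]; field_simp
    have h4 : √(θ * V) = r * θ := by
      rw [h3, show θ * (r ^ 2 * θ) = (r * θ) ^ 2 by ring, Real.sqrt_sq (by positivity)]
    calc |S| ≤ 2 * (2 / r) * V + 2 * θ * r := by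
          refine h.trans (add_le_add ?_ ?_)
          · gcongr
          · exact mul_le_mul ha h1 (by positivity) (by positivity)
      _ = 6 * √(θ * V) := by rw [h4, h3]; field_simp; ring
      _ ≤ _ := by gcongr; nlinarith [sq_nonneg (L * θ)]

/-- A time-uniform empirical Bernstein inequality. -/
theorem measureReal_exists_sqrt_lt_abs_sum_le (hZ : ∀ k, Measurable[ℱ (k + 1)] (Z k))
    (hL0 : 0 < L) (hL : ∀ k, ∀ᵐ ω ∂μ, |Z k ω| ≤ L) {δ : ℝ} (hδ : 0 < δ) (hδ1 : δ < 1) (T : ℕ) :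
    μ.real {ω | ∃ t ≤ T, 1 ≤ t ∧ 6 * √(AdamPP.theta t δ * ∑ k ∈ Finset.range t, Z k ω ^ 2 +
      L ^ 2 * AdamPP.theta t δ ^ 2) < |∑ k ∈ Finset.range t, (Z k ω - (μ[Z k | ℱ k]) ω)|} ≤ δ := by
  set S : ℕ → Ω → ℝ := fun t ω => ∑ k ∈ Finset.range t, (Z k ω - (μ[Z k | ℱ k]) ω) with hS
  set V : ℕ → Ω → ℝ := fun t ω => ∑ k ∈ Finset.range t, Z k ω ^ 2 with hV
  set c : ℕ → ℝ := fun j => 1 / (2 ^ j * (2 * L)) with hc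
  set a : ℕ → ℝ := fun j => Real.log (2 * (j + 1) * (j + 2) / δ) with ha
  have hc0 : ∀ j, 0 < c j := fun j => by positivity
  have hcL : ∀ j, |c j| * L ≤ 1 / 2 := by
    intro j
    rw [abs_of_pos (hc0 j), hc]
    have : (1 : ℝ) ≤ 2 ^ j := one_le_pow₀ one_le_two
    simp only
    rw [div_mul_eq_mul_div, one_mul, div_le_div_iff₀ (by positivity) two_pos]
    nlinarith
  -- Both signs of the parameter are needed for the absolute value. Each has failure probability `δ
  -- / (2 (j+1) (j+2))`, so the sum over `j` telescopes to at most `δ`.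
  set E : ℕ → Set Ω := fun j =>
    {ω | ∃ t ≤ T, a j ≤ c j * S t ω - 2 * c j ^ 2 * V t ω} ∪
      {ω | ∃ t ≤ T, a j ≤ -c j * S t ω - 2 * (-c j) ^ 2 * V t ω} with hE
  have hEμ : ∀ j, μ.real (E j) ≤ δ * (1 / ((j : ℝ) + 1) - 1 / ((j : ℝ) + 1 + 1)) := by
    intro j
    have h1 := measureReal_exists_le_sum_le hZ hL (hcL j) (a j) T
    have h2 := measureReal_exists_le_sum_le hZ hL (by rw [abs_neg]; exact hcL j) (c := -c j) (a j) T
    have h3 : Real.exp (-a j) = δ / (2 * (j + 1) * (j + 2)) := by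
      rw [Real.exp_neg, ha, Real.exp_log (by positivity), inv_div]
    refine (measureReal_union_le _ _).trans ((add_le_add h1 h2).trans_eq ?_)
    rw [h3]
    field_simp
    ring
  have hsub : ∀ᵐ ω ∂μ, ω ∈ {ω | ∃ t ≤ T, 1 ≤ t ∧ 6 * √(AdamPP.theta t δ * V t ω +
      L ^ 2 * AdamPP.theta t δ ^ 2) < |S t ω|} → ω ∈ ⋃ j ∈ Finset.range (T + 1), E j := by
    filter_upwards [ae_all_iff.2 hL] with ω hω
    rintro ⟨t, htT, ht1, hlt⟩
    by_contra hcon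
    simp only [Set.mem_iUnion, Finset.mem_range, not_exists] at hcon
    refine absurd hlt (not_lt.2 (abs_le_sqrt_of_forall_scale hL0 hδ hδ1 ht1
      (Finset.sum_nonneg fun k _ => sq_nonneg _) ?_ ?_))
    · calc V t ω ≤ ∑ k ∈ Finset.range t, L ^ 2 :=
            Finset.sum_le_sum fun k _ => sq_le_sq' (neg_le_of_abs_le (hω k)) (le_of_abs_le (hω k))
        _ = _ := by simp
    · intro j hj
      have h := hcon j (by omega)
      simp only [hE, Set.mem_union, Set.mem_ofPred_eq, not_or, not_exists, not_and, not_le] at h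
      have h1 := h.1 t htT
      have h2 := h.2 t htT
      have hk : ∀ x : ℝ, c j * x - 2 * c j ^ 2 * V t ω < a j →
          x ≤ 2 * c j * V t ω + a j * (2 ^ j * (2 * L)) := by
        intro x hx
        have h3 : (2 : ℝ) ^ j * (2 * L) = (c j)⁻¹ := by simp [hc]
        rw [h3, ← div_eq_mul_inv, ← sub_le_iff_le_add', le_div_iff₀ (hc0 j)]
        nlinarith
      exact abs_le'.2 ⟨hk _ h1, hk _ (by rw [neg_sq] at h2; linarith)⟩
  have hmono : μ.real {ω | ∃ t ≤ T, 1 ≤ t ∧ 6 * √(AdamPP.theta t δ * V t ω +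
      L ^ 2 * AdamPP.theta t δ ^ 2) < |S t ω|} ≤ μ.real (⋃ j ∈ Finset.range (T + 1), E j) :=
    ENNReal.toReal_mono (measure_ne_top _ _) (measure_mono_ae hsub)
  refine hmono.trans ((measureReal_biUnion_finset_le _ _).trans
    ((Finset.sum_le_sum fun j _ => hEμ j).trans ?_))
  rw [← Finset.mul_sum]
  have htel := Finset.sum_range_sub' (fun j : ℕ => 1 / ((j : ℝ) + 1)) (T + 1)
  push_cast at htel
  rw [htel]
  have : (0 : ℝ) ≤ 1 / ((T : ℝ) + 1 + 1) := by positivity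
  nlinarith

end Concentration

/-! ### The iterates, the vector regret and the stopping index -/

namespace AdamPP

theorem norm_div_sqrt_le {d : ℕ} (x : Vec d) : ‖x‖ / √d ≤ ‖WithLp.ofLp x‖ := by
  refine div_le_of_le_mul₀ (Real.sqrt_nonneg _) (norm_nonneg _) ?_
  rw [EuclideanSpace.norm_eq]
  refine Real.sqrt_le_iff.2 ⟨by positivity, ?_⟩
  rw [mul_pow, Real.sq_sqrt (Nat.cast_nonneg d)]
  calc ∑ i, ‖x i‖ ^ 2 ≤ ∑ _i : Fin d, ‖WithLp.ofLp x‖ ^ 2 :=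
        Finset.sum_le_sum fun i _ => pow_le_pow_left₀ (norm_nonneg _) (norm_le_pi_norm _ i) 2
    _ = _ := by simp [mul_comm]

theorem sum_le_sqrt_mul_norm {d : ℕ} (x : Vec d) : ∑ i, x i ≤ √d * ‖x‖ := by
  rw [EuclideanSpace.norm_eq, ← Real.sqrt_mul (Nat.cast_nonneg d)]
  refine Real.le_sqrt_of_sq_le ?_
  have := sq_sum_le_card_mul_sum_sq (s := Finset.univ) (f := fun i => x i)
  simpa using this

theorem norm_le_norm_of_abs_le {d : ℕ} {x y : Vec d} (h : ∀ i, |x i| ≤ |y i|) : ‖x‖ ≤ ‖y‖ := by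
  rw [EuclideanSpace.norm_eq, EuclideanSpace.norm_eq]
  exact Real.sqrt_le_sqrt (Finset.sum_le_sum fun i _ => pow_le_pow_left₀ (norm_nonneg _) (h i) 2)

namespace Input

variable {d : ℕ} (A : Input d) (g : ℕ → Vec d)

theorem x_succ_apply (t : ℕ) (i : Fin d) :
    A.x g (t + 1) i = A.x g t i - A.η g t * (A.m g t i / A.h g t i) := rfl

theorem η_succ (t : ℕ) :
    A.η g (t + 1) = max (A.η g t) (‖A.x g (t + 1) - A.x₀‖ / √d) := rfl

theorem η_mono : Monotone (A.η g) :=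
  monotone_nat_of_le_succ fun t => by rw [η_succ]; exact le_max_left _ _

theorem η₀_le (t : ℕ) : A.η₀ ≤ A.η g t := A.η_mono g (Nat.zero_le t)

theorem abs_sub_le_D (xs : Vec d) {k t : ℕ} (h : k ≤ t) (i : Fin d) :
    |A.x g k i - xs i| ≤ A.D g xs t :=
  (norm_le_pi_norm (WithLp.ofLp (A.x g k - xs)) i).trans
    (le_runMax (fun k => ‖WithLp.ofLp (A.x g k - xs)‖) h)

theorem D_nonneg (xs : Vec d) (t : ℕ) : 0 ≤ A.D g xs t :=
  (norm_nonneg _).trans (le_runMax (fun k => ‖WithLp.ofLp (A.x g k - xs)‖) le_rfl)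

/-- The Euclidean norm divided by `√d` is at most the sup norm, and `x_t - x₀` is bounded by `2 D`
through `x*`. -/
theorem η_le_max (xs : Vec d) (t : ℕ) : A.η g t ≤ max A.η₀ (2 * A.D g xs t) := by
  induction t with
  | zero => exact le_max_left _ _
  | succ t ih =>
    have hD : A.D g xs t ≤ A.D g xs (t + 1) := runMax_mono _ t.le_succ
    rw [η_succ]
    refine max_le (ih.trans (max_le_max le_rfl (by linarith))) (le_max_of_le_right ?_)
    refine (norm_div_sqrt_le _).trans ?_
    have h1 := le_runMax (fun k => ‖WithLp.ofLp (A.x g k - xs)‖) (le_refl (t + 1))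
    have h2 := le_runMax (fun k => ‖WithLp.ofLp (A.x g k - xs)‖) (Nat.zero_le (t + 1))
    have h3 : WithLp.ofLp (A.x g (t + 1) - A.x₀) =
      WithLp.ofLp (A.x g (t + 1) - xs) - WithLp.ofLp (A.x g 0 - xs) := by
      ext i
      simp [x, traj]
    rw [h3, two_mul]
    exact (norm_sub_le _ _).trans (add_le_add h1 h2)

theorem m_zero_apply (i : Fin d) : A.m g 0 i = (1 - A.β₁ * A.lam ^ 0) * g 0 i := rfl

theorem m_succ_apply (t : ℕ) (i : Fin d) :
    A.m g (t + 1) i =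
      A.β₁ * A.lam ^ (t + 1) * A.m g t i + (1 - A.β₁ * A.lam ^ (t + 1)) * g (t + 1) i := rfl

theorem h_apply (t : ℕ) (i : Fin d) : A.h g t i = A.stab + A.s g t i := rfl

theorem v_nonneg (h0 : 0 ≤ A.β₂) (h1 : A.β₂ < 1) (t : ℕ) (i : Fin d) : 0 ≤ A.v g t i := by
  have h2 : 0 ≤ 1 - A.β₂ := by linarith
  induction t with
  | zero => exact mul_nonneg h2 (sq_nonneg _)
  | succ t ih => exact add_nonneg (mul_nonneg h0 ih) (mul_nonneg h2 (sq_nonneg _))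

theorem isGradScale (h0 : 0 < A.β₂) (h1 : A.β₂ < 1) (i : Fin d) :
    IsGradScale (1 - A.β₂)⁻¹ (fun t => g t i) fun t => A.s g t i := by
  have hκ : 1 ≤ (1 - A.β₂)⁻¹ := (one_le_inv₀ (by linarith)).2 (by linarith)
  cases hA : A.variant with
  | case1 =>
    have : (fun t => A.s g t i) = fun t => √(∑ k ∈ Finset.range (t + 1), g k i ^ 2) := by
      ext t; simp [s, hA]
    rw [this]
    exact isGradScale_sqrt_sum hκ fun k => g k i
  | case2 =>
    have : (fun t => A.s g t i) =
        fun t : ℕ => √(((t : ℝ) + 1) * runMax (fun k => A.v g k i) t) := by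
      ext t; simp [s, hA]
    rw [this]
    refine isGradScale_sqrt_mul_runMax h1 rfl hκ fun t => ?_
    cases t with
    | zero => exact le_rfl
    | succ t => exact le_add_of_nonneg_left (mul_nonneg h0.le (A.v_nonneg g h0.le h1 t i))

variable {A g}

/-- With no stabilizer, the first nonzero gradient moves the iterate by a multiple of `η₀`. -/
theorem eq_zero_or_η₀_le (hA : A.variant = .case1) (hstab : A.stab = 0) (hβ0 : 0 ≤ A.β₁)
    (hβ : A.β₁ < 1) (hl0 : 0 ≤ A.lam) (hl : A.lam ≤ 1) (hη : 0 ≤ A.η₀) (xs : Vec d) (n : ℕ) :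
    (∀ t ≤ n, g t = 0) ∨ (1 - A.β₁) * A.η₀ ≤ 2 * A.D g xs (n + 1) := by
  by_contra! hcon
  obtain ⟨hne, hlt⟩ := hcon
  classical
  have hex : ∃ t, g t ≠ 0 := hne.imp fun t h => h.2
  obtain ⟨t₀, ht₀, hg₀⟩ := hne
  set t := Nat.find hex with ht
  have htn : t ≤ n := (Nat.find_min' hex hg₀).trans ht₀
  have hprev : ∀ k < t, g k = 0 := fun k hk => not_not.1 (Nat.find_min hex hk)
  obtain ⟨i, hi⟩ : ∃ i, g t i ≠ 0 := by
    by_contra! h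
    exact Nat.find_spec hex (by ext i; exact h i)
  have hmprev : ∀ k < t, A.m g k i = 0 := by
    intro k
    induction k with
    | zero => intro hk; simp [m_zero_apply, hprev 0 hk]
    | succ k ih => intro hk; simp [m_succ_apply, ih (by omega), hprev _ hk]
  have hm : A.m g t i = (1 - A.β₁ * A.lam ^ t) * g t i := by
    cases h : t with
    | zero => rfl
    | succ k => rw [m_succ_apply, hmprev k (by omega)]; ring
  have hh : A.h g t i = |g t i| := by
    have hs : A.s g t i = √(∑ k ∈ Finset.range (t + 1), g k i ^ 2) := by simp [s, hA]
    rw [h_apply, hstab, zero_add, hs, Finset.sum_range_succ, Finset.sum_eq_zero, zero_add,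
      Real.sqrt_sq_eq_abs]
    intro k hk
    simp [hprev k (Finset.mem_range.1 hk)]
  have hb : A.β₁ * A.lam ^ t ≤ A.β₁ := mul_le_of_le_one_right hβ0 (pow_le_one₀ hl0 hl)
  have hmove : |A.x g t i - A.x g (t + 1) i| = A.η g t * (1 - A.β₁ * A.lam ^ t) := by
    rw [x_succ_apply, sub_sub_cancel, hm, hh, abs_mul, abs_div, abs_mul, abs_abs,
      mul_div_cancel_right₀ _ (abs_ne_zero.2 hi), abs_of_nonneg (hη.trans (A.η₀_le g t)),
      abs_of_nonneg (by linarith)]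
  have h1 := A.abs_sub_le_D g xs (show t ≤ n + 1 by omega) i
  have h2 := A.abs_sub_le_D g xs (show t + 1 ≤ n + 1 by omega) i
  have h3 := abs_sub_le (A.x g t i) (xs i) (A.x g (t + 1) i)
  rw [abs_sub_comm (xs i), hmove] at h3
  have h4 : A.η₀ * (1 - A.β₁) ≤ A.η g t * (1 - A.β₁ * A.lam ^ t) :=
    mul_le_mul (A.η₀_le g t) (by linarith) (by linarith) (hη.trans (A.η₀_le g t))
  linarith

theorem h_mono (h0 : 0 < A.β₂) (h1 : A.β₂ < 1) (i : Fin d) : Monotone fun t => A.h g t i :=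
  fun _ _ h => add_le_add_right ((A.isGradScale g h0 h1 i).mono h) _

theorem norm_h_mono (h0 : 0 < A.β₂) (h1 : A.β₂ < 1) (hst : 0 ≤ A.stab) :
    Monotone fun t => ‖A.h g t‖ := fun a b h => norm_le_norm_of_abs_le fun i => by
  have h2 : 0 ≤ A.h g a i := add_nonneg hst ((A.isGradScale g h0 h1 i).nonneg a)
  have h3 : A.h g a i ≤ A.h g b i := h_mono h0 h1 i h
  rw [abs_of_nonneg h2, abs_of_nonneg (h2.trans h3)]
  exact h3

theorem norm_s_mono (h0 : 0 < A.β₂) (h1 : A.β₂ < 1) :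
    Monotone fun t => ‖A.s g t‖ := fun a b h => norm_le_norm_of_abs_le fun i => by
  have hs := A.isGradScale g h0 h1 i
  rw [abs_of_nonneg (hs.nonneg a), abs_of_nonneg (hs.nonneg b)]
  exact hs.mono h

theorem sum_norm_sq_le (h0 : 0 < A.β₂) (h1 : A.β₂ < 1) (n : ℕ) :
    ∑ k ∈ Finset.range (n + 1), ‖g k‖ ^ 2 ≤ (1 - A.β₂)⁻¹ * ‖A.s g n‖ ^ 2 := by
  simp only [EuclideanSpace.real_norm_sq_eq]
  rw [Finset.sum_comm, Finset.mul_sum]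
  exact Finset.sum_le_sum fun i _ => (A.isGradScale g h0 h1 i).sum_sq_le n

/-- The regret of the iterates, when `η_n` is within a factor `K` of `D_{n+1}`. -/
theorem regret_le (hβ0 : 0 ≤ A.β₁) (hβ : A.β₁ < 1) (hβ₂0 : 0 < A.β₂) (hβ₂ : A.β₂ < 1)
    (hl0 : 0 ≤ A.lam) (hl : A.lam < 1) (hη : 0 ≤ A.η₀) (hst : 0 ≤ A.stab) {K : ℝ} (hK : 0 ≤ K)
    {xs : Vec d} {n : ℕ} (hηD : A.η g n ≤ K * A.D g xs (n + 1)) :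
    2 * ∑ t ∈ Finset.range (n + 1), A.η g t * ⟪g t, A.x g t - xs⟫ ≤
      (1 + 2 * (1 - A.β₂)⁻¹ / (1 - A.β₁) * K ^ 2 + 4 * (1 - A.β₂)⁻¹ / (1 - A.lam) * K) *
        (A.D g xs (n + 1) ^ 2 * √d * ‖A.h g n‖) := by
  have hκ : 0 < (1 - A.β₂)⁻¹ := inv_pos.2 (by linarith)
  set κ := (1 - A.β₂)⁻¹ with hκdef
  set D := A.D g xs (n + 1) with hD
  have hD0 : 0 ≤ D := A.D_nonneg g xs _
  have h1β : 0 < 1 - A.β₁ := by linarith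
  have h1l : 0 < 1 - A.lam := by linarith
  set M := 1 + 2 * κ / (1 - A.β₁) * K ^ 2 + 4 * κ / (1 - A.lam) * K with hM
  have hηn : 0 ≤ A.η g n := hη.trans (A.η₀_le g n)
  have hcoord : ∀ i, 2 * ∑ t ∈ Finset.range (n + 1), A.η g t * (g t i * (A.x g t i - xs i)) ≤
      M * D ^ 2 * A.h g n i := by
    intro i
    have hs := A.isGradScale g hβ₂0 hβ₂ i
    have hsh : ∀ t, A.s g t i ≤ A.h g t i := fun t => le_add_of_nonneg_left hst
    have h1 := hs.regret_le (m := fun t => A.m g t i) hκ.le hβ0 hβ hl0 hl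
      (A.m_zero_apply g i) (fun t => A.m_succ_apply g t i)
      (h_mono hβ₂0 hβ₂ i) hsh (y := fun t => A.x g t i - xs i)
      (fun t => by rw [x_succ_apply]; ring) (A.η_mono g) hη (n := n) (D := D)
      (fun t ht => A.abs_sub_le_D g xs ht i)
    refine h1.trans ?_
    have h2 : 2 * κ / (1 - A.β₁) * A.η g n ^ 2 + 4 * κ / (1 - A.lam) * (A.η g n * D) ≤
        (M - 1) * D ^ 2 := by
      have h3 : A.η g n ^ 2 ≤ (K * D) ^ 2 := pow_le_pow_left₀ hηn hηD 2
      have h4 : A.η g n * D ≤ K * D * D := mul_le_mul_of_nonneg_right hηD hD0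
      have h5 := mul_le_mul_of_nonneg_left h3 (by positivity : 0 ≤ 2 * κ / (1 - A.β₁))
      have h6 := mul_le_mul_of_nonneg_left h4 (by positivity : 0 ≤ 4 * κ / (1 - A.lam))
      rw [hM]
      linarith
    have h7 : 0 ≤ (M - 1) * D ^ 2 := by
      refine mul_nonneg ?_ (sq_nonneg D)
      rw [hM, add_assoc, add_sub_cancel_left]
      positivity
    calc _ ≤ A.h g n i * D ^ 2 + (M - 1) * D ^ 2 * A.h g n i :=
          add_le_add le_rfl (mul_le_mul h2 (hsh n) (hs.nonneg n) h7)
      _ = _ := by ring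
  have hM0 : 0 ≤ M := by rw [hM]; positivity
  calc 2 * ∑ t ∈ Finset.range (n + 1), A.η g t * ⟪g t, A.x g t - xs⟫
      = ∑ i, 2 * ∑ t ∈ Finset.range (n + 1), A.η g t * (g t i * (A.x g t i - xs i)) := by
        rw [← Finset.mul_sum, Finset.sum_comm]
        congr 1
        refine Finset.sum_congr rfl fun t _ => ?_
        rw [← Finset.mul_sum, PiLp.inner_apply]
        congr 1
        exact Finset.sum_congr rfl fun i _ => by simp [mul_comm]
    _ ≤ ∑ i, M * D ^ 2 * A.h g n i := Finset.sum_le_sum fun i _ => hcoord i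
    _ ≤ M * D ^ 2 * (√d * ‖A.h g n‖) := by
        rw [← Finset.mul_sum]
        exact mul_le_mul_of_nonneg_left (sum_le_sqrt_mul_norm _) (by positivity)
    _ = _ := by ring

theorem IsStopIndex.pos (hη : 0 < A.η₀) {T τ : ℕ} (hT : 1 ≤ T) (h : A.IsStopIndex g T τ) :
    1 ≤ τ := by
  by_contra! h0
  have h1 := h.2 1 hT
  rw [Nat.lt_one_iff.1 h0, Finset.sum_range_zero, Finset.sum_range_one] at h1
  exact absurd h1 (not_le.2 (div_pos (hη.trans_le (A.η₀_le g 0)) (hη.trans_le (A.η₀_le g 1))))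

theorem IsStopIndex.mul_le_sum (hη : 0 < A.η₀) {T n : ℕ} (h : A.IsStopIndex g T (n + 1)) :
    A.η g n * T ≤ 2 * logPlus (A.η g T / A.η₀) * ∑ k ∈ Finset.range (n + 1), A.η g k := by
  have hpos : ∀ t, 0 < A.η g t := fun t => hη.trans_le (A.η₀_le g t)
  set P := ∑ k ∈ Finset.range (n + 1), A.η g k with hP
  -- The maximum with 1 meets the condition `1 ≤ R` of the growth lemma. It costs nothing, because
  -- `η_n` is itself a term of `P`.
  set R := max 1 (P / A.η g (n + 1)) with hR
  have h1 : (T : ℝ) ≤ 2 * R * (1 + Real.log (A.η g T / A.η g 0)) := by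
    refine le_two_mul_mul_one_add_log (A.η_mono g) (hpos 0) (le_max_left _ _) fun t ht => ?_
    have h2 := h.2 t ht
    rw [← Finset.sum_div, ← Finset.sum_div] at h2
    rw [← div_le_iff₀ (hpos t)]
    exact h2.trans (le_max_right _ _)
  have h2 : R * A.η g n ≤ P := by
    rw [hR, max_mul_of_nonneg _ _ (hpos n).le, one_mul]
    refine max_le ?_ ?_
    · exact Finset.single_le_sum (f := A.η g) (fun k _ => (hpos k).le) (Finset.self_mem_range_succ n)
    · rw [div_mul_eq_mul_div]
      refine div_le_of_le_mul₀ (hpos _).le (Finset.sum_nonneg fun k _ => (hpos k).le) ?_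
      exact mul_le_mul_of_nonneg_left (A.η_mono g n.le_succ)
        (Finset.sum_nonneg fun k _ => (hpos k).le)
  have hl : 0 ≤ logPlus (A.η g T / A.η₀) :=
    add_nonneg zero_le_one (Real.log_nonneg ((one_le_div hη).2 (A.η₀_le g T)))
  calc A.η g n * T ≤ A.η g n * (2 * R * logPlus (A.η g T / A.η₀)) :=
        mul_le_mul_of_nonneg_left h1 (hpos n).le
    _ = 2 * logPlus (A.η g T / A.η₀) * (R * A.η g n) := by ring
    _ ≤ _ := mul_le_mul_of_nonneg_left h2 (by positivity)

/-! ### Measurability of the iterates -/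

section Measurability

variable {Ω : Type*} {m₀ : MeasurableSpace Ω} {g : ℕ → Ω → Vec d}

theorem measurable_m {t : ℕ} (hg : ∀ k ≤ t, Measurable (g k)) :
    Measurable fun ω => A.m (path g ω) t := by
  induction t with
  | zero => exact (hg 0 le_rfl).const_smul (1 - A.beta1 0)
  | succ t ih =>
    exact ((ih fun k hk => hg k (by omega)).const_smul (A.beta1 (t + 1))).add
      ((hg (t + 1) le_rfl).const_smul (1 - A.beta1 (t + 1)))

theorem measurable_v {t : ℕ} (hg : ∀ k ≤ t, Measurable (g k)) (i : Fin d) :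
    Measurable fun ω => A.v (path g ω) t i := by
  have hgi : ∀ k ≤ t, Measurable fun ω => g k ω i := fun k hk =>
    (EuclideanSpace.proj (𝕜 := ℝ) i).continuous.measurable.comp (hg k hk)
  induction t with
  | zero => exact ((hgi 0 le_rfl).pow_const 2).const_mul _
  | succ t ih =>
    exact ((ih (fun k hk => hg k (by omega)) fun k hk => hgi k (by omega)).const_mul _).add
      (((hgi (t + 1) le_rfl).pow_const 2).const_mul _)

theorem measurable_s {t : ℕ} (hg : ∀ k ≤ t, Measurable (g k)) (i : Fin d) :
    Measurable fun ω => A.s (path g ω) t i := by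
  have hgi : ∀ k ≤ t, Measurable fun ω => g k ω i := fun k hk =>
    (EuclideanSpace.proj (𝕜 := ℝ) i).continuous.measurable.comp (hg k hk)
  cases hA : A.variant with
  | case1 =>
    simp only [s, hA]
    exact (Finset.measurable_fun_sum _ fun k hk =>
      (hgi k (Finset.mem_range_succ_iff.1 hk)).pow_const 2).sqrt
  | case2 =>
    simp only [s, hA, runMax]
    refine Measurable.sqrt (Measurable.const_mul ?_ _)
    exact Finset.measurable_range_sup'' fun k hk => measurable_v (fun j hj => hg j (hj.trans hk)) i

/-- The σ-algebra is arbitrary so that it can be `ℱ t`: only the gradients before time `t` enter,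
which makes the iterates predictable. -/
theorem measurable_traj {t : ℕ} (hg : ∀ k < t, Measurable (g k)) :
    Measurable fun ω => A.traj (path g ω) t := by
  induction t with
  | zero => exact measurable_const
  | succ t ih =>
    have h1 := ih fun k hk => hg k (by omega)
    have hx : Measurable fun ω => (A.traj (path g ω) t).1 := h1.fst
    have hη : Measurable fun ω => (A.traj (path g ω) t).2 := h1.snd
    have hm := measurable_m (A := A) (t := t) (g := g) fun k hk => hg k (by omega)
    have hstep : Measurable fun ω => (WithLp.toLp 2 fun i =>
        A.m (path g ω) t i / A.h (path g ω) t i : Vec d) := by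
      refine (WithLp.measurable_toLp 2 _).comp (measurable_pi_lambda _ fun i => ?_)
      exact ((EuclideanSpace.proj (𝕜 := ℝ) i).continuous.measurable.comp hm).div
        ((measurable_s (fun k hk => hg k (by omega)) i).const_add _)
    have hx' := hx.sub (hη.smul hstep)
    exact hx'.prodMk (hη.max ((hx'.sub_const _).norm.div_const _))

theorem measurable_x {t : ℕ} (hg : ∀ k < t, Measurable (g k)) :
    Measurable fun ω => A.x (path g ω) t := (measurable_traj hg).fst

theorem measurable_Dbar {t : ℕ} (hg : ∀ k < t, Measurable (g k)) (xs : Vec d) :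
    Measurable fun ω => A.Dbar (path g ω) xs t :=
  Finset.measurable_range_sup'' fun _ hk =>
    ((measurable_x fun j hj => hg j (hj.trans_le hk)).sub_const xs).norm

end Measurability

end Input

end AdamPP

/-! ### The optimality gap on a path, and the truncated directions -/

namespace AdamPP

namespace Input

variable {d : ℕ} {A : Input d}

/-- The optimality gap on a path of gradients `g` along which the noise is controlled. -/
theorem gap_le_of_noise_le (hβ0 : 0 ≤ A.β₁) (hβ : A.β₁ < 1) (hβ₂0 : 0 < A.β₂) (hβ₂ : A.β₂ < 1)
    (hl0 : 0 ≤ A.lam) (hl : A.lam < 1) (hη : 0 < A.η₀) (hst : 0 ≤ A.stab)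
    {f : Vec d → ℝ} (hf : ConvexOn ℝ Set.univ f) {g p : ℕ → Vec d}
    (hp : ∀ k, p k ∈ subdiff f (A.x g k)) {xs : Vec d} {T n : ℕ} (hT : 1 ≤ T) {B : ℝ}
    (hB : ∀ t ≤ n + 1,
      |∑ k ∈ Finset.range t, ⟪p k - g k, (A.Dbar g xs k)⁻¹ • (A.x g k - xs)⟫| ≤ B)
    (hτ : A.IsStopIndex g T (n + 1))
    (hcase : (A.variant = .case1 ∧ A.stab = 0) ∨ A.η₀ ≤ A.D g xs (n + 1)) :
    f (A.xbar g (n + 1)) ≤ f xs +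
      ((1 + 2 * (1 - A.β₂)⁻¹ / (1 - A.β₁) * (2 / (1 - A.β₁)) ^ 2 +
          4 * (1 - A.β₂)⁻¹ / (1 - A.lam) * (2 / (1 - A.β₁))) *
        (A.D g xs (n + 1) ^ 2 * √d * ‖A.h g (n + 1)‖ / (A.η₀ * T)) +
        4 * A.Dbar g xs (n + 1) * B / T) * logPlus (A.η g T / A.η₀) := by
  have h1β : 0 < 1 - A.β₁ := by linarith
  have h1l : 0 < 1 - A.lam := by linarith
  have hκ : 0 < (1 - A.β₂)⁻¹ := inv_pos.2 (by linarith)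
  have hT0 : (0 : ℝ) < T := by exact_mod_cast hT
  have hpos : ∀ t, 0 < A.η g t := fun t => hη.trans_le (A.η₀_le g t)
  -- `K` serves both cases: it is at least 2, as `η_n ≤ max η₀ (2 D)` requires, and it is the factor
  -- in `η₀ ≤ 2 D / (1 - β₁)` after a first nonzero gradient.
  set K := 2 / (1 - A.β₁) with hK
  have hK2 : 2 ≤ K := by rw [hK, le_div_iff₀ h1β]; linarith
  set M := 1 + 2 * (1 - A.β₂)⁻¹ / (1 - A.β₁) * K ^ 2 + 4 * (1 - A.β₂)⁻¹ / (1 - A.lam) * K with hM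
  have hM0 : 0 ≤ M := by positivity
  set D := A.D g xs (n + 1) with hD
  have hD0 : 0 ≤ D := A.D_nonneg g xs _
  set Q := D ^ 2 * √d * ‖A.h g (n + 1)‖ with hQ
  have hQ0 : 0 ≤ Q := by positivity
  have hDb0 : ∀ k, 0 ≤ A.Dbar g xs k := fun k =>
    (norm_nonneg _).trans (le_runMax (fun k => ‖A.x g k - xs‖) le_rfl)
  have hB0 : 0 ≤ B := (abs_nonneg _).trans (hB 0 (by omega))
  set ℓ := logPlus (A.η g T / A.η₀) with hℓ
  have hℓ0 : 0 ≤ ℓ :=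
    add_nonneg zero_le_one (Real.log_nonneg ((one_le_div hη).2 (A.η₀_le g T)))
  -- the regret of the stochastic gradients
  have hreg : 2 * ∑ t ∈ Finset.range (n + 1), A.η g t * ⟪g t, A.x g t - xs⟫ ≤ M * Q := by
    have hmain : A.η g n ≤ K * D →
        2 * ∑ t ∈ Finset.range (n + 1), A.η g t * ⟪g t, A.x g t - xs⟫ ≤ M * Q := by
      intro h
      refine (regret_le hβ0 hβ hβ₂0 hβ₂ hl0 hl hη.le hst (by linarith) h).trans ?_
      refine mul_le_mul_of_nonneg_left ?_ hM0
      exact mul_le_mul_of_nonneg_left (norm_h_mono hβ₂0 hβ₂ hst n.le_succ) (by positivity)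
    have hηD : A.η₀ ≤ K * D → A.η g n ≤ K * D := by
      intro h
      have hDn : A.D g xs n ≤ D := runMax_mono _ n.le_succ
      exact (A.η_le_max g xs n).trans (max_le h (by nlinarith))
    rcases hcase with ⟨h1, h2⟩ | h1
    · rcases eq_zero_or_η₀_le (g := g) h1 h2 hβ0 hβ hl0 hl.le hη.le xs n with h3 | h3
      · have h4 : ∑ t ∈ Finset.range (n + 1), A.η g t * ⟪g t, A.x g t - xs⟫ = 0 := by
          refine Finset.sum_eq_zero fun k hk => ?_
          simp [h3 k (Finset.mem_range_succ_iff.1 hk)]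
        rw [h4, mul_zero]
        positivity
      · refine hmain (hηD ?_)
        rw [hK, div_mul_eq_mul_div, le_div_iff₀ h1β]
        linarith
    · exact hmain (hηD (by nlinarith))
  -- the noise
  have hnoise : ∑ t ∈ Finset.range (n + 1), A.η g t * ⟪p t - g t, A.x g t - xs⟫ ≤
      2 * (A.η g n * A.Dbar g xs (n + 1)) * B := by
    have hmono : Monotone fun k => A.η g k * A.Dbar g xs k := fun a b hab =>
      mul_le_mul (A.η_mono g hab) (runMax_mono _ hab) (hDb0 a) (hpos b).le
    have h1 := (le_abs_self _).trans (abs_sum_mul_le_of_monotone hmono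
      (mul_nonneg (hpos 0).le (hDb0 0)) hB)
    have h2 : A.η g n * A.Dbar g xs n ≤ A.η g n * A.Dbar g xs (n + 1) :=
      mul_le_mul_of_nonneg_left (runMax_mono _ n.le_succ) (hpos n).le
    refine le_trans (le_of_eq ?_) (h1.trans (mul_le_mul_of_nonneg_right (by linarith) hB0))
    refine Finset.sum_congr rfl fun k _ => ?_
    rw [inner_smul_right]
    -- The normalization by `D̄_k` is undone here. If `D̄_k = 0`, then `x_k = x*` and both terms
    -- vanish.
    rcases (hDb0 k).eq_or_lt with h0 | h0
    · have h3 : ‖A.x g k - xs‖ ≤ 0 := h0 ▸ le_runMax (fun k => ‖A.x g k - xs‖) (le_refl k)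
      rw [norm_le_zero_iff.1 h3]
      simp
    · field_simp
  -- Jensen
  set P := ∑ k ∈ Finset.range (n + 1), A.η g k with hP
  have hP0 : 0 < P := Finset.sum_pos (fun k _ => hpos k) ⟨0, by simp⟩
  have hjensen : P * (f (A.xbar g (n + 1)) - f xs) ≤
      ∑ k ∈ Finset.range (n + 1), A.η g k * ⟪p k, A.x g k - xs⟫ := by
    have h1 := hf.map_centerMass_le (t := Finset.range (n + 1)) (w := A.η g) (p := A.x g)
      (fun k _ => (hpos k).le) hP0 fun _ _ => Set.mem_univ _
    have h2 : f (A.xbar g (n + 1)) ≤ P⁻¹ * ∑ k ∈ Finset.range (n + 1), A.η g k * f (A.x g k) := h1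
    rw [← div_eq_inv_mul, le_div_iff₀ hP0] at h2
    have h3 : ∑ k ∈ Finset.range (n + 1), A.η g k * f (A.x g k) ≤
        ∑ k ∈ Finset.range (n + 1), (A.η g k * f xs + A.η g k * ⟪p k, A.x g k - xs⟫) := by
      refine Finset.sum_le_sum fun k _ => ?_
      have h4 := hp k xs
      rw [← neg_sub, inner_neg_right] at h4
      rw [← mul_add]
      exact mul_le_mul_of_nonneg_left (by linarith) (hpos k).le
    rw [Finset.sum_add_distrib, ← Finset.sum_mul] at h3
    linarith
  have hsplit : ∑ k ∈ Finset.range (n + 1), A.η g k * ⟪p k, A.x g k - xs⟫ =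
      ∑ t ∈ Finset.range (n + 1), A.η g t * ⟪g t, A.x g t - xs⟫ +
      ∑ t ∈ Finset.range (n + 1), A.η g t * ⟪p t - g t, A.x g t - xs⟫ := by
    rw [← Finset.sum_add_distrib]
    refine Finset.sum_congr rfl fun k _ => ?_
    rw [inner_sub_left]
    ring
  have hweight := hτ.mul_le_sum hη
  have hrhs : 0 ≤ M * (Q / (A.η₀ * T)) + 4 * A.Dbar g xs (n + 1) * B / T := by
    have := hDb0 (n + 1)
    positivity
  -- The lower bound on the total weight is multiplied by the gap, which must be nonnegative. A
  -- nonpositive gap needs no argument.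
  rcases le_total (f (A.xbar g (n + 1)) - f xs) 0 with hE | hE
  · linarith [mul_nonneg hrhs hℓ0]
  · have h1 : (f (A.xbar g (n + 1)) - f xs) * (A.η g n * T) ≤
        ℓ * (M * Q + 4 * (A.η g n * A.Dbar g xs (n + 1)) * B) := by
      have h2 := mul_le_mul_of_nonneg_left hweight hE
      have h3 : P * (f (A.xbar g (n + 1)) - f xs) ≤
        M * Q / 2 + 2 * (A.η g n * A.Dbar g xs (n + 1)) * B := by linarith
      have h4 := mul_le_mul_of_nonneg_left h3 hℓ0
      linarith
    rw [← le_div_iff₀ (mul_pos (hpos n) hT0)] at h1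
    have h5 : ℓ * (M * Q + 4 * (A.η g n * A.Dbar g xs (n + 1)) * B) / (A.η g n * T) =
        (M * (Q / (A.η g n * T)) + 4 * A.Dbar g xs (n + 1) * B / T) * ℓ := by
      have := (hpos n).ne'
      field_simp
    have h6 : Q / (A.η g n * T) ≤ Q / (A.η₀ * T) :=
      div_le_div_of_nonneg_left hQ0 (by positivity)
        (mul_le_mul_of_nonneg_right (A.η₀_le g n) hT0.le)
    have h7 : (M * (Q / (A.η g n * T)) + 4 * A.Dbar g xs (n + 1) * B / T) * ℓ ≤
        (M * (Q / (A.η₀ * T)) + 4 * A.Dbar g xs (n + 1) * B / T) * ℓ :=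
      mul_le_mul_of_nonneg_right
        (add_le_add (mul_le_mul_of_nonneg_left h6 hM0) le_rfl) hℓ0
    linarith

/-- The unit direction from `xs` to `x_k`, set to zero where the gradient bound exceeds `L`. -/
noncomputable def direction {Ω : Type*} (A : Input d) (g : ℕ → Ω → Vec d) (l : Vec d → ℝ) (L : ℝ) (xs : Vec d)
    (k : ℕ) : Ω → Vec d :=
  {ω | l (A.x (path g ω) k) ≤ L}.indicator fun ω =>
    (A.Dbar (path g ω) xs k)⁻¹ • (A.x (path g ω) k - xs)

theorem norm_direction_le {Ω : Type*} (g : ℕ → Ω → Vec d) (l : Vec d → ℝ) (L : ℝ) (xs : Vec d)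
    (k : ℕ) (ω : Ω) : ‖A.direction g l L xs k ω‖ ≤ 1 := by
  refine (norm_indicator_le_norm_self _ _).trans ?_
  have h : ‖A.x (path g ω) k - xs‖ ≤ A.Dbar (path g ω) xs k :=
    le_runMax (fun k => ‖A.x (path g ω) k - xs‖) le_rfl
  have h0 : 0 ≤ A.Dbar (path g ω) xs k := (norm_nonneg _).trans h
  rw [norm_smul, norm_inv, Real.norm_of_nonneg h0, ← div_eq_inv_mul]
  exact div_le_one_of_le₀ h h0

/-- Applied with `ℱ k` as the σ-algebra, this allows the direction to be pulled out of the
conditional mean of `⟪g k, u k⟫`. -/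
theorem measurable_direction {Ω : Type*} {m₀ : MeasurableSpace Ω} {g : ℕ → Ω → Vec d} {k : ℕ}
    (hg : ∀ j < k, Measurable (g j)) {l : Vec d → ℝ} (hl : Continuous l) (L : ℝ) (xs : Vec d) :
    Measurable (A.direction g l L xs k) :=
  (((measurable_Dbar hg xs).inv).smul ((measurable_x hg).sub_const xs)).indicator
    (measurableSet_le (hl.measurable.comp (measurable_x hg)) measurable_const)

end Input

end AdamPP

/-! ### The bound with high probability -/

theorem theorem2 (β₁ β₂ lam : ℝ) (hβ₁ : 0 < β₁) (hβ₁₂ : β₁ < √β₂) (hβ₂ : β₂ < 1)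
    (hlam₀ : 0 < lam) (hlam₁ : lam < 1) :
    ∃ C : ℝ, 0 < C ∧
      ∀ (d : ℕ) (A : AdamPP.Input d), A.β₁ = β₁ → A.β₂ = β₂ → A.lam = lam →
      0 < A.η₀ → 0 ≤ A.stab →
      ∀ (f : AdamPP.Vec d → ℝ), ConvexOn ℝ Set.univ f →
      ∀ (Ω : Type*) (mΩ : MeasurableSpace Ω) (μ : Measure Ω), IsProbabilityMeasure μ →
      ∀ (ℱ : Filtration ℕ mΩ) (g : ℕ → Ω → AdamPP.Vec d), AdamPP.IsOracleRun A μ ℱ f g →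
      ∀ (l : AdamPP.Vec d → ℝ), Continuous l →
      (∀ t, ∀ᵐ ω ∂μ, ‖g t ω‖ ≤ l (A.x (AdamPP.path g ω) t)) →
      ∀ (T : ℕ), 1 ≤ T →
      ∀ (δ : ℝ), 0 < δ → δ < 1 → ∀ (L : ℝ), 0 < L → ∀ (xs : AdamPP.Vec d),
        1 - δ - μ.real {ω | L < AdamPP.runMax (fun t => l (A.x (AdamPP.path g ω) t)) T} ≤
          μ.real {ω | ∀ τ, A.IsStopIndex (AdamPP.path g ω) T τ →
            ((A.variant = .case1 ∧ A.stab = 0) ∨ A.η₀ ≤ A.D (AdamPP.path g ω) xs τ) →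
            f (A.xbar (AdamPP.path g ω) τ) ≤
              f xs + C * A.rate (AdamPP.path g ω) xs T τ L δ} := by
  have hβ₂0 : 0 < β₂ := Real.sqrt_pos.1 (hβ₁.trans hβ₁₂)
  have hβ₁1 : β₁ < 1 := hβ₁₂.trans (by rw [Real.sqrt_lt' one_pos]; linarith)
  have h1β : 0 < 1 - β₁ := by linarith
  have h1l : 0 < 1 - lam := by linarith
  have hκ : 1 ≤ (1 - β₂)⁻¹ := (one_le_inv₀ (by linarith)).2 (by linarith)
  have hκ0 : 0 < (1 - β₂)⁻¹ := zero_lt_one.trans_le hκ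
  set M := 1 + 2 * (1 - β₂)⁻¹ / (1 - β₁) * (2 / (1 - β₁)) ^ 2 +
    4 * (1 - β₂)⁻¹ / (1 - lam) * (2 / (1 - β₁)) with hM
  have hM0 : 0 < M := by positivity
  -- `M` comes from the regret. The 24 is the factor 4 of the noise in the gap bound times the 6 of
  -- the Bernstein inequality.
  refine ⟨M + 24 * (1 - β₂)⁻¹, by positivity, ?_⟩
  rintro d A hA₁ hA₂ hA₃ hη hst f hf Ω mΩ μ hμ ℱ g hrun l hlc hgl T hT δ hδ hδ1 L hL xs
  have hgm : ∀ k t, k < t → Measurable[ℱ t] (g k) := fun k t hkt =>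
    (hrun.measurable k).mono (ℱ.mono hkt) le_rfl
  set u := A.direction g l L xs with hu
  have hum : ∀ k, Measurable[ℱ k] (u k) := fun k =>
    AdamPP.Input.measurable_direction (fun j hj => hgm j k hj) hlc L xs
  have hu1 : ∀ k ω, ‖u k ω‖ ≤ 1 := fun k ω => AdamPP.Input.norm_direction_le g l L xs k ω
  set Z : ℕ → Ω → ℝ := fun k ω => ⟪g k ω, u k ω⟫ with hZ
  have hZm : ∀ k, Measurable[ℱ (k + 1)] (Z k) := fun k =>
    (hrun.measurable k).inner ((hum k).mono (ℱ.mono k.le_succ) le_rfl)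
  have hZL : ∀ k, ∀ᵐ ω ∂μ, |Z k ω| ≤ L := fun k => by
    filter_upwards [hgl k] with ω hω
    by_cases hLω : l (A.x (AdamPP.path g ω) k) ≤ L
    · calc |Z k ω| ≤ ‖g k ω‖ * ‖u k ω‖ := abs_real_inner_le_norm _ _
        _ ≤ ‖g k ω‖ := mul_le_of_le_one_right (norm_nonneg _) (hu1 k ω)
        _ ≤ L := hω.trans hLω
    · have : u k ω = 0 := Set.indicator_of_notMem
        (s := {ω | l (A.x (AdamPP.path g ω) k) ≤ L}) hLω _
      simp [hZ, this, hL.le]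
  have hZp : ∀ k, ∀ᵐ ω ∂μ, (μ[Z k | ℱ k]) ω = ⟪(μ[g k | ℱ k]) ω, u k ω⟫ := fun k => by
    refine condExp_bilin_of_stronglyMeasurable_right (innerSL ℝ) (hum k).stronglyMeasurable ?_
      (hrun.integrable k)
    exact Integrable.of_bound ((hZm k).mono (ℱ.le _) le_rfl).aestronglyMeasurable L (hZL k)
  set bad₁ : Set Ω := {ω | L < AdamPP.runMax (fun t => l (A.x (AdamPP.path g ω) t)) T} with hbad₁
  set bad₂ : Set Ω := {ω | ∃ t ≤ T, 1 ≤ t ∧ 6 * √(AdamPP.theta t δ *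
    ∑ k ∈ Finset.range t, Z k ω ^ 2 + L ^ 2 * AdamPP.theta t δ ^ 2) <
      |∑ k ∈ Finset.range t, (Z k ω - (μ[Z k | ℱ k]) ω)|} with hbad₂
  have hbad₂μ : μ.real bad₂ ≤ δ := measureReal_exists_sqrt_lt_abs_sum_le hZm hL hZL hδ hδ1 T
  set good : Set Ω := {ω | ∀ τ, A.IsStopIndex (AdamPP.path g ω) T τ →
    ((A.variant = .case1 ∧ A.stab = 0) ∨ A.η₀ ≤ A.D (AdamPP.path g ω) xs τ) →
    f (A.xbar (AdamPP.path g ω) τ) ≤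
      f xs + (M + 24 * (1 - β₂)⁻¹) * A.rate (AdamPP.path g ω) xs T τ L δ} with hgood
  have hcover : ∀ᵐ ω ∂μ, ω ∈ Set.univ → ω ∈ good ∪ (bad₁ ∪ bad₂) := by
    filter_upwards [ae_all_iff.2 hZp, ae_all_iff.2 hrun.mean_mem] with ω hpω hmω _
    by_contra hcon
    simp only [Set.mem_union, not_or] at hcon
    obtain ⟨hng, hn₁, hn₂⟩ := hcon
    refine hng ?_
    intro τ hτ hcase
    obtain ⟨n, rfl⟩ : ∃ n, τ = n + 1 := ⟨τ - 1, by have := hτ.pos hη hT; omega⟩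
    have hnT : n + 1 ≤ T := hτ.1
    have huω : ∀ k ≤ T, u k ω =
        (A.Dbar (AdamPP.path g ω) xs k)⁻¹ • (A.x (AdamPP.path g ω) k - xs) := by
      intro k hk
      refine Set.indicator_of_mem (s := {ω | l (A.x (AdamPP.path g ω) k) ≤ L}) ?_ _
      exact (AdamPP.le_runMax (fun t => l (A.x (AdamPP.path g ω) t)) hk).trans (not_lt.1 hn₁)
    set θ := AdamPP.theta (n + 1) δ with hθ
    have hθ1 : 1 ≤ θ := AdamPP.one_le_theta (by omega) hδ hδ1
    set S := ‖A.s (AdamPP.path g ω) (n + 1)‖ with hS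
    set R := √(θ * S ^ 2 + L ^ 2 * θ ^ 2) with hR
    have hV : ∑ k ∈ Finset.range (n + 1), Z k ω ^ 2 ≤ (1 - β₂)⁻¹ * S ^ 2 := by
      have h1 := AdamPP.Input.sum_norm_sq_le (A := A) (g := AdamPP.path g ω)
        (hA₂ ▸ hβ₂0) (hA₂ ▸ hβ₂) n
      have h2 := AdamPP.Input.norm_s_mono (A := A) (g := AdamPP.path g ω)
        (hA₂ ▸ hβ₂0) (hA₂ ▸ hβ₂) n.le_succ
      rw [hA₂] at h1
      calc ∑ k ∈ Finset.range (n + 1), Z k ω ^ 2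
          ≤ ∑ k ∈ Finset.range (n + 1), ‖AdamPP.path g ω k‖ ^ 2 := by
            refine Finset.sum_le_sum fun k _ => ?_
            rw [← sq_abs]
            refine pow_le_pow_left₀ (abs_nonneg _) ?_ 2
            exact (abs_real_inner_le_norm _ _).trans
              (mul_le_of_le_one_right (norm_nonneg _) (hu1 k ω))
        _ ≤ _ := h1
        _ ≤ _ := mul_le_mul_of_nonneg_left (pow_le_pow_left₀ (norm_nonneg _) h2 2) hκ0.le
    have hB : ∀ t ≤ n + 1, |∑ k ∈ Finset.range t, ⟪(μ[g k | ℱ k]) ω - AdamPP.path g ω k,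
        (A.Dbar (AdamPP.path g ω) xs k)⁻¹ • (A.x (AdamPP.path g ω) k - xs)⟫| ≤
        6 * ((1 - β₂)⁻¹ * R) := by
      intro t ht
      rcases Nat.eq_zero_or_pos t with rfl | ht0
      · simp only [Finset.range_zero, Finset.sum_empty, abs_zero]
        positivity
      have h1 : |∑ k ∈ Finset.range t, (Z k ω - (μ[Z k | ℱ k]) ω)| ≤
          6 * √(AdamPP.theta t δ * ∑ k ∈ Finset.range t, Z k ω ^ 2 +
            L ^ 2 * AdamPP.theta t δ ^ 2) := by
        by_contra! h
        exact hn₂ ⟨t, ht.trans hnT, ht0, h⟩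
      have h2 : ∑ k ∈ Finset.range t, ⟪(μ[g k | ℱ k]) ω - AdamPP.path g ω k,
          (A.Dbar (AdamPP.path g ω) xs k)⁻¹ • (A.x (AdamPP.path g ω) k - xs)⟫ =
          -∑ k ∈ Finset.range t, (Z k ω - (μ[Z k | ℱ k]) ω) := by
        rw [← Finset.sum_neg_distrib]
        refine Finset.sum_congr rfl fun k hk => ?_
        have hk' := Finset.mem_range.1 hk
        rw [← huω k (by omega), hpω k, inner_sub_left, neg_sub]
        rfl
      rw [h2, abs_neg]
      refine h1.trans (mul_le_mul_of_nonneg_left ?_ (by norm_num))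
      have hθt : AdamPP.theta t δ ≤ θ := AdamPP.theta_mono ht0 ht hδ
      have hθt0 : 0 ≤ AdamPP.theta t δ := zero_le_one.trans (AdamPP.one_le_theta ht0 hδ hδ1)
      have hVt : ∑ k ∈ Finset.range t, Z k ω ^ 2 ≤ (1 - β₂)⁻¹ * S ^ 2 :=
        (Finset.sum_le_sum_of_subset_of_nonneg (Finset.range_subset_range.2 ht)
          fun _ _ _ => sq_nonneg _).trans hV
      rw [hR, ← Real.sqrt_sq hκ0.le, ← Real.sqrt_mul (sq_nonneg _)]
      refine Real.sqrt_le_sqrt ?_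
      have h3 : AdamPP.theta t δ * ∑ k ∈ Finset.range t, Z k ω ^ 2 ≤ θ * ((1 - β₂)⁻¹ * S ^ 2) :=
        mul_le_mul hθt hVt (Finset.sum_nonneg fun _ _ => sq_nonneg _) (by linarith)
      have h4 : L ^ 2 * AdamPP.theta t δ ^ 2 ≤ L ^ 2 * θ ^ 2 :=
        mul_le_mul_of_nonneg_left (pow_le_pow_left₀ hθt0 hθt 2) (sq_nonneg L)
      -- The sum of squares of `Z` is at most `κ S²` with `κ = (1 - β₂)⁻¹ ≥ 1`. Enlarging `κ` and 1
      -- to `κ²` lets `κ` leave the square root.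
      have h5 : (1 - β₂)⁻¹ ≤ (1 - β₂)⁻¹ ^ 2 := by nlinarith
      have h6 : (1 - β₂)⁻¹ * (θ * S ^ 2) ≤ (1 - β₂)⁻¹ ^ 2 * (θ * S ^ 2) :=
        mul_le_mul_of_nonneg_right h5 (by positivity)
      have h7 : 1 * (L ^ 2 * θ ^ 2) ≤ (1 - β₂)⁻¹ ^ 2 * (L ^ 2 * θ ^ 2) :=
        mul_le_mul_of_nonneg_right (hκ.trans h5) (by positivity)
      linarith
    have hgap := AdamPP.Input.gap_le_of_noise_le (A := A) (hA₁ ▸ hβ₁.le) (hA₁ ▸ hβ₁1)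
      (hA₂ ▸ hβ₂0) (hA₂ ▸ hβ₂) (hA₃ ▸ hlam₀.le) (hA₃ ▸ hlam₁) hη hst hf
      (p := fun k => (μ[g k | ℱ k]) ω) hmω hT hB hτ hcase
    rw [hA₁, hA₂, hA₃, ← hM] at hgap
    refine hgap.trans (add_le_add le_rfl ?_)
    rw [AdamPP.Input.rate, ← mul_assoc (M + 24 * (1 - β₂)⁻¹)]
    have hℓ0 : 0 ≤ AdamPP.logPlus (A.η (AdamPP.path g ω) T / A.η₀) :=
      add_nonneg zero_le_one (Real.log_nonneg ((one_le_div hη).2 (A.η₀_le _ T)))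
    refine mul_le_mul_of_nonneg_right ?_ hℓ0
    have hDb : 0 ≤ A.Dbar (AdamPP.path g ω) xs (n + 1) := (norm_nonneg _).trans
      (AdamPP.le_runMax (fun k => ‖A.x (AdamPP.path g ω) k - xs‖) le_rfl)
    have ha : 0 ≤ A.D (AdamPP.path g ω) xs (n + 1) ^ 2 * √d *
      ‖A.h (AdamPP.path g ω) (n + 1)‖ / (A.η₀ * T) := by positivity
    have hb : 0 ≤ A.Dbar (AdamPP.path g ω) xs (n + 1) * R / T := by positivity
    have hc : 4 * A.Dbar (AdamPP.path g ω) xs (n + 1) * (6 * ((1 - β₂)⁻¹ * R)) / T =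
      24 * (1 - β₂)⁻¹ * (A.Dbar (AdamPP.path g ω) xs (n + 1) * R / T) := by ring
    rw [hc]
    have h1 := mul_nonneg (by positivity : 0 ≤ 24 * (1 - β₂)⁻¹) ha
    have h2 := mul_nonneg hM0.le hb
    linarith
  -- Only monotonicity and subadditivity are used, so none of the three events has to be measurable.
  have huniv : μ.real Set.univ ≤ μ.real (good ∪ (bad₁ ∪ bad₂)) :=
    ENNReal.toReal_mono (measure_ne_top _ _) (measure_mono_ae hcover)
  rw [probReal_univ] at huniv
  have h1 := measureReal_union_le (μ := μ) good (bad₁ ∪ bad₂)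
  have h2 := measureReal_union_le (μ := μ) bad₁ bad₂
  linarith
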